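/- Let $K$ be an algebraically closed field and let $Q$ be an acyclic quiver (possibly infinite), i.e. a quiver in which every path from a vertex to itself is trivial. Let $KQ$ be the $K$-vector space with basis all paths of $Q$. It is the path algebra under concatenation of paths, and the path coalgebra under $\Delta(p)=\sum_{\eta\tau=p}\eta\otimes\tau$ and $\varepsilon(p)=1$ if $p$ has length $0$, $\varepsilon(p)=0$ otherwise. Let $C\subseteq KQ$ be an admissible subcoalgebra, i.e. a subcoalgebra containing all vertices (trivial paths) and all arrows of $Q$. A relation ideal of $KQ$ is a two-sided ideal $\Omega$ of the path algebra $KQ$ contained in the span $KQ_{\geq 2}$ of the paths of length at least $2$. The path coalgebra of the quiver with relations $(Q,\Omega)$ is $C(Q,\Omega)=\{a\in KQ \mid \langle a,\Omega\rangle=0\}$, where $\langle -,-\rangle$ is the bilinear form on $KQ$ with $\langle p,q\rangle=\delta_{p,q}$ for paths $p,q$. Suppose that $C$ is not the path coalgebra of a quiver with relations, i.e. $C\neq C(Q,\Omega)$ for every relation ideal $\Omega$ of $KQ$. Then $C$ is of wild comodule type: if $\Gamma$ denotes the quiver with two vertices and three parallel arrows from one to the other, there is an exact and faithful $K$-linear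 functor $F$ from the category of finite dimensional right $K\Gamma$-modules to the category of finite dimensional right $C$-comodules such that $F(X)\cong F(Y)$ implies $X\cong Y$ and such that $F(X)$ is indecomposable whenever $X$ is indecomposable. -/

import Mathlib

open CategoryTheory
open scoped TensorProduct

/-! ### Paths and the vector space `KQ` spanned by them

A quiver is a type of vertices `V` with a `Quiver V` structure.  There are no finiteness assumptions. -/

/-- The set of all paths of a quiver: `⟨a, b, p⟩` is a path `p` from `a` to `b`. -/
abbrev PathIn (V : Type*) [Quiver V] : Type _ := Σ a b : V, Quiver.Path a b

/-- A quiver is acyclic if it has no oriented cycle, that is, every path from a vertex to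
itself is trivial. -/
def QuiverIsAcyclic (V : Type*) [Quiver V] : Prop :=
  ∀ (a : V) (p : Quiver.Path a a), p = Quiver.Path.nil

/-- `KQ`: the `K`-vector space with basis the set of all paths. -/
def PathSpace (K : Type*) [Field K] (V : Type*) [Quiver V] : Type _ := PathIn V →₀ K

namespace PathSpace

variable {K : Type*} [Field K] {V : Type*} [Quiver V]

noncomputable instance : AddCommGroup (PathSpace K V) :=
  inferInstanceAs (AddCommGroup (PathIn V →₀ K))

noncomputable instance : Module K (PathSpace K V) :=
  inferInstanceAs (Module K (PathIn V →₀ K))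

/-- The basis of `KQ` formed by the paths. -/
noncomputable def pathBasis (K : Type*) [Field K] (V : Type*) [Quiver V] :
    Module.Basis (PathIn V) K (PathSpace K V) :=
  Module.Basis.ofRepr (LinearEquiv.refl K (PathIn V →₀ K))

/-- A path, as an element of `KQ`. -/
noncomputable def ofPath (K : Type*) [Field K] {V : Type*} [Quiver V] {a b : V}
    (p : Quiver.Path a b) : PathSpace K V := pathBasis K V ⟨a, b, p⟩

/-- The coefficient of a path in an element of `KQ`. -/
noncomputable def coeff (x : PathSpace K V) (p : PathIn V) : K := (pathBasis K V).repr x p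

theorem pathBasis_mk {a b : V} (p : Quiver.Path a b) :
    pathBasis K V ⟨a, b, p⟩ = ofPath K p := rfl

/-- Two linear maps out of `KQ` agree if they agree on paths. -/
theorem hom_ext {M : Type*} [AddCommGroup M] [Module K M] {f g : PathSpace K V →ₗ[K] M}
    (h : ∀ (a b : V) (p : Quiver.Path a b), f (ofPath K p) = g (ofPath K p)) : f = g :=
  (pathBasis K V).ext fun ⟨a, b, p⟩ => h a b p

/-! ### The path algebra -/

open Classical in
/-- The product `p q` of two paths: first `q`, then `p`, if `q` ends where `p` starts;
zero otherwise. -/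
noncomputable def pathMul (K : Type*) [Field K] {V : Type*} [Quiver V] (p q : PathIn V) :
    PathSpace K V :=
  if h : q.2.1 = p.1 then ofPath K ((q.2.2.cast rfl h).comp p.2.2) else 0

/-- The multiplication of the path algebra `KQ`, as a bilinear map. -/
noncomputable def mulLin (K : Type*) [Field K] (V : Type*) [Quiver V] :
    PathSpace K V →ₗ[K] PathSpace K V →ₗ[K] PathSpace K V :=
  (pathBasis K V).constr K fun p => (pathBasis K V).constr K fun q => pathMul K p q

noncomputable instance : Mul (PathSpace K V) := ⟨fun x y => mulLin K V x y⟩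

theorem mulLin_apply (x y : PathSpace K V) : mulLin K V x y = x * y := rfl

theorem ofPath_mul_ofPath {a b c : V} (p : Quiver.Path b c) (q : Quiver.Path a b) :
    ofPath K p * ofPath K q = ofPath K (q.comp p) := by
  rw [← mulLin_apply, mulLin, ← pathBasis_mk, ← pathBasis_mk, Module.Basis.constr_basis,
    Module.Basis.constr_basis]
  simp [pathMul]

theorem ofPath_mul_ofPath_of_ne {a b c d : V} (p : Quiver.Path c d) (q : Quiver.Path a b)
    (h : b ≠ c) : ofPath K p * ofPath K q = 0 := by
  rw [← mulLin_apply, mulLin, ← pathBasis_mk, ← pathBasis_mk, Module.Basis.constr_basis,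
    Module.Basis.constr_basis]
  simp [pathMul, h]

private theorem mul_assoc_aux (x y z : PathSpace K V) : x * y * z = x * (y * z) := by
  have key : (mulLin K V).compr₂ (mulLin K V) =
      (LinearMap.llcomp K (PathSpace K V) (PathSpace K V) (PathSpace K V) ∘ₗ
        mulLin K V).compl₂ (mulLin K V) := by
    refine hom_ext fun c d p => hom_ext fun b c' q => hom_ext fun a b' r => ?_
    simp only [LinearMap.compr₂_apply, LinearMap.compl₂_apply, LinearMap.comp_apply,
      LinearMap.llcomp_apply, mulLin_apply]
    by_cases h : c' = c
    · subst h
      rw [ofPath_mul_ofPath]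
      by_cases h' : b' = b
      · subst h'
        rw [ofPath_mul_ofPath, ofPath_mul_ofPath, ofPath_mul_ofPath, Quiver.Path.comp_assoc]
      · rw [ofPath_mul_ofPath_of_ne _ _ h', ofPath_mul_ofPath_of_ne _ _ h', ← mulLin_apply,
          map_zero]
    · rw [ofPath_mul_ofPath_of_ne _ _ h, ← mulLin_apply, map_zero, LinearMap.zero_apply]
      by_cases h' : b' = b
      · subst h'
        rw [ofPath_mul_ofPath, ofPath_mul_ofPath_of_ne _ _ h]
      · rw [ofPath_mul_ofPath_of_ne _ _ h', ← mulLin_apply, map_zero]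
  exact LinearMap.congr_fun (LinearMap.congr_fun (LinearMap.congr_fun key x) y) z

/-- The (not necessarily unital) path algebra `KQ`. -/
noncomputable instance : NonUnitalRing (PathSpace K V) where
  left_distrib x y z := (mulLin K V x).map_add y z
  right_distrib x y z := LinearMap.congr_fun ((mulLin K V).map_add x y) z
  zero_mul x := LinearMap.congr_fun (mulLin K V).map_zero x
  mul_zero x := (mulLin K V x).map_zero
  mul_assoc := mul_assoc_aux

instance : IsScalarTower K (PathSpace K V) (PathSpace K V) :=
  ⟨fun c x y => LinearMap.congr_fun ((mulLin K V).map_smul c x) y⟩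

instance : SMulCommClass K (PathSpace K V) (PathSpace K V) :=
  ⟨fun c x y => ((mulLin K V x).map_smul c y).symm⟩

section Finite

variable [Fintype V]

private theorem one_mul_aux (x : PathSpace K V) :
    (∑ v : V, ofPath K (Quiver.Path.nil : Quiver.Path v v)) * x = x := by
  have : mulLin K V (∑ v : V, ofPath K (Quiver.Path.nil : Quiver.Path v v)) = LinearMap.id := by
    refine hom_ext fun a b p => ?_
    rw [mulLin_apply, Finset.sum_mul, Finset.sum_eq_single b]
    · rw [ofPath_mul_ofPath, Quiver.Path.comp_nil, LinearMap.id_apply]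
    · exact fun v _ hv => ofPath_mul_ofPath_of_ne _ _ hv.symm
    · simp
  exact LinearMap.congr_fun this x

private theorem mul_one_aux (x : PathSpace K V) :
    x * (∑ v : V, ofPath K (Quiver.Path.nil : Quiver.Path v v)) = x := by
  have : (mulLin K V).flip (∑ v : V, ofPath K (Quiver.Path.nil : Quiver.Path v v)) =
      LinearMap.id := by
    refine hom_ext fun a b p => ?_
    rw [LinearMap.flip_apply, mulLin_apply, Finset.mul_sum, Finset.sum_eq_single a]
    · rw [ofPath_mul_ofPath, Quiver.Path.nil_comp, LinearMap.id_apply]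
    · exact fun v _ hv => ofPath_mul_ofPath_of_ne _ _ hv
    · simp
  exact LinearMap.congr_fun this x

/-- If `Q` has finitely many vertices, then the path algebra is unital, with unit the sum of
the trivial paths. -/
noncomputable instance : Ring (PathSpace K V) :=
  { (inferInstance : NonUnitalRing (PathSpace K V)) with
    one := ∑ v : V, ofPath K (Quiver.Path.nil : Quiver.Path v v)
    one_mul := one_mul_aux
    mul_one := mul_one_aux }

noncomputable instance : Algebra K (PathSpace K V) :=
  Algebra.ofModule smul_mul_assoc mul_smul_comm

end Finite

/-! ### The path coalgebra -/

/-- All factorizations `p = η τ` of a path `p` from `a` to `b` (first `τ`, then `η`), each listed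
once, as triples `⟨c, τ, η⟩` with `τ` a path from `a` to `c` and `η` a path from `c` to `b`. -/
def splits {a : V} : {b : V} → Quiver.Path a b →
    List (Σ c : V, Quiver.Path a c × Quiver.Path c b)
  | _, .nil => [⟨a, .nil, .nil⟩]
  | _, .cons (c := c) p α =>
      ⟨c, p.cons α, .nil⟩ :: (splits p).map fun s => ⟨s.1, s.2.1, s.2.2.cons α⟩

theorem mem_splits {a b : V} (p : Quiver.Path a b) (c : V) (τ : Quiver.Path a c)
    (η : Quiver.Path c b) : ⟨c, τ, η⟩ ∈ splits p ↔ τ.comp η = p := by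
  induction p generalizing c with
  | nil =>
    simp only [splits, List.mem_singleton]
    constructor
    · intro h
      cases h
      rfl
    · intro h
      cases η with
      | nil => cases h; rfl
      | cons η β => cases h
  | cons p α ih =>
    simp only [splits, List.mem_cons, List.mem_map]
    constructor
    · rintro (h | ⟨⟨c', τ', η'⟩, hs, h⟩)
      · cases h
        rfl
      · cases h
        rw [Quiver.Path.comp_cons, (ih _ _ _).1 hs]
    · intro h
      cases η with
      | nil => left; cases h; rfl
      | cons η β =>
        right
        cases h
        exact ⟨⟨c, τ, η⟩, (ih c τ η).2 rfl, rfl⟩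

theorem nodup_splits {a b : V} (p : Quiver.Path a b) : (splits p).Nodup := by
  induction p with
  | nil => simp [splits]
  | cons p α ih =>
    rw [splits, List.nodup_cons]
    constructor
    · rw [List.mem_map]
      rintro ⟨⟨c, τ, η⟩, -, h⟩
      obtain ⟨rfl, h⟩ := Sigma.mk.inj h
      exact Quiver.Path.cons_ne_nil _ _ (Prod.mk.inj (eq_of_heq h)).2
    · refine ih.map ?_
      rintro ⟨c, τ, η⟩ ⟨c', τ', η'⟩ h
      cases h
      rfl

/-- The comultiplication on `KQ`: `Δ(p) = ∑_{η τ = p} η ⊗ τ`. -/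
noncomputable def comulLin (K : Type*) [Field K] (V : Type*) [Quiver V] :
    PathSpace K V →ₗ[K] PathSpace K V ⊗[K] PathSpace K V :=
  (pathBasis K V).constr K fun p =>
    ((splits p.2.2).map fun s => ofPath K s.2.2 ⊗ₜ[K] ofPath K s.2.1).sum

/-- The counit of `KQ`: it is `1` on trivial paths and `0` on paths of length at least one. -/
noncomputable def counitLin (K : Type*) [Field K] (V : Type*) [Quiver V] :
    PathSpace K V →ₗ[K] K :=
  (pathBasis K V).constr K fun p => if p.2.2.length = 0 then 1 else 0

theorem comulLin_ofPath {a b : V} (p : Quiver.Path a b) :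
    comulLin K V (ofPath K p) =
      ((splits p).map fun s => ofPath K s.2.2 ⊗ₜ[K] ofPath K s.2.1).sum := by
  rw [comulLin, ← pathBasis_mk, Module.Basis.constr_basis]

theorem counitLin_ofPath {a b : V} (p : Quiver.Path a b) :
    counitLin K V (ofPath K p) = if p.length = 0 then 1 else 0 := by
  rw [counitLin, ← pathBasis_mk, Module.Basis.constr_basis]

theorem comulLin_nil (a : V) : comulLin K V (ofPath K (.nil : Quiver.Path a a)) =
    ofPath K (.nil : Quiver.Path a a) ⊗ₜ ofPath K (.nil : Quiver.Path a a) := by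
  simp [comulLin_ofPath, splits]

private theorem cons_eq_mul {a b c : V} (p : Quiver.Path a b) (α : b ⟶ c) :
    ofPath K (p.cons α) = ofPath K α.toPath * ofPath K p := by
  rw [ofPath_mul_ofPath]; rfl

private theorem comulLin_cons {a b c : V} (p : Quiver.Path a b) (α : b ⟶ c) :
    comulLin K V (ofPath K (p.cons α)) =
      ofPath K (.nil : Quiver.Path c c) ⊗ₜ ofPath K (p.cons α) +
        (mulLin K V (ofPath K α.toPath)).rTensor _ (comulLin K V (ofPath K p)) := by
  rw [comulLin_ofPath, comulLin_ofPath, splits, List.map_cons, List.sum_cons, map_list_sum,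
    List.map_map, List.map_map]
  congr 3
  funext s
  simp [mulLin_apply, cons_eq_mul]

private theorem comulLin_arrow_mul {b c : V} (α : b ⟶ c) :
    comulLin K V ∘ₗ mulLin K V (ofPath K α.toPath) =
      TensorProduct.mk K _ _ (ofPath K (.nil : Quiver.Path c c)) ∘ₗ
        mulLin K V (ofPath K α.toPath) +
        (mulLin K V (ofPath K α.toPath)).rTensor _ ∘ₗ comulLin K V := by
  refine hom_ext fun a b' p => ?_
  simp only [LinearMap.comp_apply, LinearMap.add_apply, mulLin_apply, TensorProduct.mk_apply]
  by_cases h : b' = b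
  · subst h
    rw [← cons_eq_mul, comulLin_cons]
  · rw [ofPath_mul_ofPath_of_ne _ _ h, map_zero, TensorProduct.tmul_zero, zero_add,
      comulLin_ofPath, map_list_sum, List.map_map]
    symm
    apply List.sum_eq_zero
    intro x hx
    obtain ⟨s, -, rfl⟩ := List.mem_map.1 hx
    simp [mulLin_apply, ofPath_mul_ofPath_of_ne _ _ h]

private theorem coassoc_aux :
    (TensorProduct.assoc K (PathSpace K V) (PathSpace K V) (PathSpace K V)).toLinearMap ∘ₗ
      (comulLin K V).rTensor _ ∘ₗ comulLin K V =
      (comulLin K V).lTensor _ ∘ₗ comulLin K V := by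
  refine hom_ext fun a b p => ?_
  simp only [LinearMap.comp_apply, LinearEquiv.coe_coe]
  induction p with
  | nil => simp [comulLin_nil]
  | @cons b c p α ih =>
    have h1 : ∀ z : PathSpace K V ⊗[K] PathSpace K V,
        TensorProduct.assoc K _ _ _ ((comulLin K V).rTensor _
          ((mulLin K V (ofPath K α.toPath)).rTensor _ z)) =
        ofPath K (.nil : Quiver.Path c c) ⊗ₜ
          (mulLin K V (ofPath K α.toPath)).rTensor _ z +
        (mulLin K V (ofPath K α.toPath)).rTensor _
          (TensorProduct.assoc K _ _ _ ((comulLin K V).rTensor _ z)) := by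
      intro z
      induction z with
      | zero => simp
      | add x y hx hy => simp only [map_add, hx, hy, TensorProduct.tmul_add]; abel
      | tmul x y =>
        have h := LinearMap.congr_fun (comulLin_arrow_mul (K := K) α) x
        simp only [LinearMap.comp_apply, LinearMap.add_apply, TensorProduct.mk_apply] at h
        simp only [LinearMap.rTensor_tmul, h, TensorProduct.add_tmul, map_add,
          TensorProduct.assoc_tmul]
        congr 1
        generalize comulLin K V x = w
        induction w with
        | zero => simp
        | add u v hu hv => simp only [map_add, TensorProduct.add_tmul, hu, hv]
        | tmul u v => simp
    have h2 : ∀ z : PathSpace K V ⊗[K] PathSpace K V,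
        (comulLin K V).lTensor _ ((mulLin K V (ofPath K α.toPath)).rTensor _ z) =
        (mulLin K V (ofPath K α.toPath)).rTensor _ ((comulLin K V).lTensor _ z) := by
      intro z
      induction z with
      | zero => simp
      | add x y hx hy => simp only [map_add, hx, hy]
      | tmul x y => simp
    rw [comulLin_cons, map_add, map_add, map_add, h1, h2, ih, LinearMap.rTensor_tmul,
      comulLin_nil, TensorProduct.assoc_tmul, LinearMap.lTensor_tmul, comulLin_cons,
      TensorProduct.tmul_add, add_assoc]

/-- The path coalgebra `KQ`. -/
noncomputable instance : Coalgebra K (PathSpace K V) where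
  comul := comulLin K V
  counit := counitLin K V
  coassoc := coassoc_aux
  rTensor_counit_comp_comul := by
    refine hom_ext fun a b p => ?_
    cases p with
    | nil => simp [comulLin_nil, counitLin_ofPath]
    | cons p α =>
      rw [LinearMap.comp_apply, comulLin_ofPath, splits, List.map_cons, List.sum_cons, map_add,
        map_list_sum, List.map_map, List.sum_eq_zero]
      · simp [counitLin_ofPath]
      · intro x hx
        rw [List.map_map] at hx
        obtain ⟨s, -, rfl⟩ := List.mem_map.1 hx
        simp [counitLin_ofPath]
  lTensor_counit_comp_comul := by
    refine hom_ext fun a b p => ?_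
    rw [LinearMap.comp_apply]
    induction p with
    | nil => simp [comulLin_nil, counitLin_ofPath]
    | cons p α ih =>
      have h : ∀ z : PathSpace K V ⊗[K] PathSpace K V,
          (counitLin K V).lTensor _ ((mulLin K V (ofPath K α.toPath)).rTensor _ z) =
          (mulLin K V (ofPath K α.toPath)).rTensor _ ((counitLin K V).lTensor _ z) := by
        intro z
        induction z with
        | zero => simp
        | add x y hx hy => simp only [map_add, hx, hy]
        | tmul x y => simp
      rw [comulLin_cons, map_add, h, ih, LinearMap.lTensor_tmul, counitLin_ofPath]
      simp [mulLin_apply, cons_eq_mul]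

end PathSpace

/-! ### Subcoalgebras -/

/-- A subcoalgebra of a `K`-coalgebra `A`: a subspace `C` with `Δ(C) ⊆ C ⊗ C`, where `C ⊗ C` is
identified with its image in `A ⊗ A`. -/
structure Subcoalgebra (K : Type*) [Field K] (A : Type*) [AddCommGroup A] [Module K A]
    [Coalgebra K A] extends Submodule K A where
  comul_mem : ∀ x ∈ toSubmodule, Coalgebra.comul (R := K) x ∈
    LinearMap.range (TensorProduct.map toSubmodule.subtype toSubmodule.subtype)

namespace Subcoalgebra

variable {K : Type*} [Field K] {A : Type*} [AddCommGroup A] [Module K A] [Coalgebra K A]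
variable (C : Subcoalgebra K A)

theorem map_subtype_injective :
    Function.Injective (TensorProduct.map C.toSubmodule.subtype C.toSubmodule.subtype) :=
  TensorProduct.map_injective_of_flat_flat _ _ C.toSubmodule.injective_subtype
    C.toSubmodule.injective_subtype

/-- The comultiplication of a subcoalgebra: the restriction of the comultiplication of `A`. -/
noncomputable def comulLin :
    C.toSubmodule →ₗ[K] C.toSubmodule ⊗[K] C.toSubmodule :=
  (LinearEquiv.ofInjective _ C.map_subtype_injective).symm.toLinearMap ∘ₗ
    (Coalgebra.comul (R := K) ∘ₗ C.toSubmodule.subtype).codRestrict _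
      (fun x => C.comul_mem x x.2)

theorem map_comulLin (x : C.toSubmodule) :
    TensorProduct.map C.toSubmodule.subtype C.toSubmodule.subtype (C.comulLin x) =
      Coalgebra.comul (R := K) (x : A) := by
  have := LinearEquiv.apply_symm_apply (LinearEquiv.ofInjective _ C.map_subtype_injective)
    ((Coalgebra.comul (R := K) ∘ₗ C.toSubmodule.subtype).codRestrict _
      (fun x => C.comul_mem x x.2) x)
  exact congrArg Subtype.val this

/-- A subcoalgebra is a coalgebra. -/
noncomputable instance : Coalgebra K C.toSubmodule where
  comul := C.comulLin
  counit := Coalgebra.counit (R := K) ∘ₗ C.toSubmodule.subtype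
  coassoc := by
    set ι := C.toSubmodule.subtype with hι
    have hinj : Function.Injective (TensorProduct.map ι (TensorProduct.map ι ι)) :=
      TensorProduct.map_injective_of_flat_flat _ _ C.toSubmodule.injective_subtype
        C.map_subtype_injective
    have hcomul : TensorProduct.map ι ι ∘ₗ C.comulLin = Coalgebra.comul (R := K) ∘ₗ ι :=
      LinearMap.ext C.map_comulLin
    ext1 x
    apply hinj
    have h1 : ∀ z : C.toSubmodule ⊗[K] C.toSubmodule,
        TensorProduct.map ι (TensorProduct.map ι ι)
          (TensorProduct.assoc K _ _ _ (C.comulLin.rTensor _ z)) =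
        TensorProduct.assoc K _ _ _ ((Coalgebra.comul (R := K)).rTensor _
          (TensorProduct.map ι ι z)) := by
      intro z
      induction z with
      | zero => simp
      | add x y hx hy => simp only [map_add, hx, hy]
      | tmul x y =>
        rw [LinearMap.rTensor_tmul, TensorProduct.map_tmul, LinearMap.rTensor_tmul,
          ← LinearMap.comp_apply (Coalgebra.comul (R := K)) ι, ← hcomul, LinearMap.comp_apply]
        generalize C.comulLin x = w
        induction w with
        | zero => simp
        | add u v hu hv => simp only [map_add, TensorProduct.add_tmul, hu, hv]
        | tmul u v => simp
    have h2 : ∀ z : C.toSubmodule ⊗[K] C.toSubmodule,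
        TensorProduct.map ι (TensorProduct.map ι ι) (C.comulLin.lTensor _ z) =
        (Coalgebra.comul (R := K)).lTensor _ (TensorProduct.map ι ι z) := by
      intro z
      induction z with
      | zero => simp
      | add x y hx hy => simp only [map_add, hx, hy]
      | tmul x y =>
        rw [LinearMap.lTensor_tmul, TensorProduct.map_tmul, TensorProduct.map_tmul,
          LinearMap.lTensor_tmul, ← LinearMap.comp_apply (Coalgebra.comul (R := K)) ι, ← hcomul,
          LinearMap.comp_apply]
    simp only [LinearMap.comp_apply, LinearEquiv.coe_coe]
    rw [h1, h2, C.map_comulLin, Coalgebra.coassoc_apply]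
  rTensor_counit_comp_comul := by
    ext1 x
    apply Module.Flat.lTensor_preserves_injective_linearMap (M := K) _
      C.toSubmodule.injective_subtype
    have h : ∀ z : C.toSubmodule ⊗[K] C.toSubmodule,
        C.toSubmodule.subtype.lTensor K
          ((Coalgebra.counit (R := K) ∘ₗ C.toSubmodule.subtype).rTensor _ z) =
        (Coalgebra.counit (R := K)).rTensor _
          (TensorProduct.map C.toSubmodule.subtype C.toSubmodule.subtype z) := by
      intro z
      induction z with
      | zero => simp
      | add x y hx hy => simp only [map_add, hx, hy]
      | tmul x y => simp
    rw [LinearMap.comp_apply, h, C.map_comulLin, Coalgebra.rTensor_counit_comul]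
    simp
  lTensor_counit_comp_comul := by
    ext1 x
    apply Module.Flat.rTensor_preserves_injective_linearMap (M := K) _
      C.toSubmodule.injective_subtype
    have h : ∀ z : C.toSubmodule ⊗[K] C.toSubmodule,
        C.toSubmodule.subtype.rTensor K
          ((Coalgebra.counit (R := K) ∘ₗ C.toSubmodule.subtype).lTensor _ z) =
        (Coalgebra.counit (R := K)).lTensor _
          (TensorProduct.map C.toSubmodule.subtype C.toSubmodule.subtype z) := by
      intro z
      induction z with
      | zero => simp
      | add x y hx hy => simp only [map_add, hx, hy]
      | tmul x y => simp
    rw [LinearMap.comp_apply, h, C.map_comulLin, Coalgebra.lTensor_counit_comul]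
    simp

end Subcoalgebra

namespace PathSpace

variable {K : Type*} [Field K] {V : Type*} [Quiver V]

/-- A subcoalgebra of `KQ` is admissible if it contains all vertices and all arrows
(equivalently, the subcoalgebra generated by them). -/
def IsAdmissible (C : Subcoalgebra K (PathSpace K V)) : Prop :=
  (∀ a : V, ofPath K (.nil : Quiver.Path a a) ∈ C.toSubmodule) ∧
    ∀ (a b : V) (α : a ⟶ b), ofPath K α.toPath ∈ C.toSubmodule

/-- A relation ideal of `KQ`: a two-sided ideal `Ω` of the path algebra with `Ω ⊆ KQ_{≥ 2}`,
that is, all paths occurring in elements of `Ω` have length at least two. -/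
def IsRelationIdeal (Ω : Submodule K (PathSpace K V)) : Prop :=
  (∀ x, ∀ ω ∈ Ω, x * ω ∈ Ω ∧ ω * x ∈ Ω) ∧
    ∀ ω ∈ Ω, ∀ p : PathIn V, coeff ω p ≠ 0 → 2 ≤ p.2.2.length

/-- The bilinear form on `KQ` for which the paths are orthonormal. -/
noncomputable def pairing (K : Type*) [Field K] (V : Type*) [Quiver V] :
    PathSpace K V →ₗ[K] PathSpace K V →ₗ[K] K :=
  (pathBasis K V).constr K fun p => (pathBasis K V).coord p

/-- The path coalgebra of a quiver with relations, `C(Q, Ω) = {a ∈ KQ | ⟨a, Ω⟩ = 0}`. -/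
noncomputable def relationCoalgebra (Ω : Submodule K (PathSpace K V)) :
    Submodule K (PathSpace K V) where
  carrier := {a | ∀ ω ∈ Ω, pairing K V a ω = 0}
  zero_mem' := fun ω _ => by simp
  add_mem' := fun {a b} ha hb ω hω => by simp [ha ω hω, hb ω hω]
  smul_mem' := fun c a ha ω hω => by simp [ha ω hω]

/-- A subcoalgebra of `KQ` is the path coalgebra of a quiver with relations if it equals
`C(Q, Ω)` for some relation ideal `Ω` of `KQ`. -/
def IsPathCoalgebraOfRelations (C : Subcoalgebra K (PathSpace K V)) : Prop :=
  ∃ Ω : Submodule K (PathSpace K V), IsRelationIdeal Ω ∧ C.toSubmodule = relationCoalgebra Ω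

end PathSpace

/-! ### Comodules -/

/-- A right comodule over a `K`-coalgebra `C`. -/
structure RightComodule.{w, u, v} (K : Type u) [Field K] (C : Type v) [AddCommGroup C] [Module K C]
    [Coalgebra K C] where
  carrier : Type w
  [addCommGroup : AddCommGroup carrier]
  [module : Module K carrier]
  /-- The coaction. -/
  coact : carrier →ₗ[K] carrier ⊗[K] C
  coassoc : TensorProduct.assoc K carrier C C ∘ₗ coact.rTensor C ∘ₗ coact =
    (Coalgebra.comul (R := K)).lTensor carrier ∘ₗ coact
  counit : TensorProduct.rid K carrier ∘ₗ (Coalgebra.counit (R := K)).lTensor carrier ∘ₗ coact =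
    LinearMap.id

namespace RightComodule

universe w u v

variable {K : Type u} [Field K] {C : Type v} [AddCommGroup C] [Module K C] [Coalgebra K C]

attribute [instance] RightComodule.addCommGroup RightComodule.module

/-- The space of morphisms of right comodules: the `K`-linear maps which commute with the
coactions. -/
def homSubmodule (M N : RightComodule.{w} K C) : Submodule K (M.carrier →ₗ[K] N.carrier) where
  carrier := {f | N.coact ∘ₗ f = f.rTensor C ∘ₗ M.coact}
  zero_mem' := by simp
  add_mem' := fun {f g} hf hg => by
    simp only [Set.mem_ofPred_eq] at hf hg ⊢
    rw [LinearMap.comp_add, hf, hg, LinearMap.rTensor_add, LinearMap.add_comp]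
  smul_mem' := fun c f hf => by
    simp only [Set.mem_ofPred_eq] at hf ⊢
    rw [LinearMap.comp_smul, hf, LinearMap.rTensor_smul, LinearMap.smul_comp]

/-- The category of right `C`-comodules. -/
instance : Category (RightComodule.{w} K C) where
  Hom M N := homSubmodule M N
  id M := ⟨LinearMap.id, by simp [homSubmodule]⟩
  comp {M N P} f g := ⟨g.1 ∘ₗ f.1, by
    have hf : N.coact ∘ₗ f.1 = f.1.rTensor C ∘ₗ M.coact := f.2
    have hg : P.coact ∘ₗ g.1 = g.1.rTensor C ∘ₗ N.coact := g.2
    change P.coact ∘ₗ (g.1 ∘ₗ f.1) = (g.1 ∘ₗ f.1).rTensor C ∘ₗ M.coact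
    rw [← LinearMap.comp_assoc, hg, LinearMap.comp_assoc, hf, LinearMap.rTensor_comp,
      LinearMap.comp_assoc]⟩

/-- The linear map underlying a morphism of comodules. -/
def Hom.toLinearMap {M N : RightComodule.{w} K C} (f : M ⟶ N) : M.carrier →ₗ[K] N.carrier :=
  Subtype.val f

instance : Preadditive (RightComodule.{w} K C) where
  homGroup M N := inferInstanceAs (AddCommGroup (homSubmodule M N))
  add_comp _ _ _ f f' g := Subtype.ext (LinearMap.comp_add (Subtype.val f) (Subtype.val f') (Subtype.val g))
  comp_add _ _ _ f g g' := Subtype.ext (LinearMap.add_comp (Subtype.val f) (Subtype.val g') (Subtype.val g))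

instance : Linear K (RightComodule.{w} K C) where
  homModule M N := inferInstanceAs (Module K (homSubmodule M N))
  smul_comp _ _ _ c f g := Subtype.ext (LinearMap.comp_smul (Subtype.val g) c (Subtype.val f))
  comp_smul _ _ _ f c g := Subtype.ext (LinearMap.smul_comp c (Subtype.val g) (Subtype.val f))

end RightComodule

/-- `M_f^C`: the category of finite dimensional right `C`-comodules. -/
abbrev FDRightComodule.{w, u, v} (K : Type u) [Field K] (C : Type v) [AddCommGroup C] [Module K C]
    [Coalgebra K C] :=
  ObjectProperty.FullSubcategory
    (fun M : RightComodule.{w} K C => FiniteDimensional K M.carrier)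

/-! ### Finite dimensional right modules and wildness -/

/-- The category of finite dimensional right modules over a `K`-algebra `A`; right `A`-modules are
modules over the opposite algebra. -/
abbrev FDRightModule.{w, u, v} (K : Type u) [Field K] (A : Type v) [Ring A] [Algebra K A] :=
  ObjectProperty.FullSubcategory
    (fun M : ModuleCat.{w} Aᵐᵒᵖ =>
      @FiniteDimensional K M _ _ (ModuleCat.moduleOfAlgebraModule (k := K) M))

/-- An object of a category with zero morphisms is indecomposable if it is nonzero and is not
the direct sum (biproduct) of two nonzero objects. -/
def IsIndecomposableObj {𝒞 : Type*} [Category 𝒞] [Limits.HasZeroMorphisms 𝒞] (X : 𝒞) : Prop :=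
  ¬ Limits.IsZero X ∧ ∀ (Y Z : 𝒞) (b : Limits.BinaryBicone Y Z), Nonempty b.IsBilimit →
    Nonempty (X ≅ b.pt) → Limits.IsZero Y ∨ Limits.IsZero Z

/-- The two vertices of the quiver with three parallel arrows. -/
inductive Kronecker₃ : Type
  | source
  | sink
  deriving DecidableEq

instance : Fintype Kronecker₃ := ⟨{.source, .sink}, by rintro (_ | _) <;> simp⟩

/-- The arrows of the quiver with three parallel arrows. -/
inductive Kronecker₃.Arrow : Kronecker₃ → Kronecker₃ → Type
  | arr (i : Fin 3) : Arrow Kronecker₃.source Kronecker₃.sink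

/-- The quiver with two vertices and three parallel arrows from one to the other. -/
instance : Quiver Kronecker₃ := ⟨Kronecker₃.Arrow⟩

/-- A functor from finite dimensional right modules to finite dimensional right comodules is
exact if it sends short exact sequences to short exact sequences. -/
def IsExactModToComod.{w, w', u, v, v'} {K : Type u} [Field K] {A : Type v} [Ring A] [Algebra K A]
    {C : Type v'} [AddCommGroup C] [Module K C] [Coalgebra K C]
    (F : FDRightModule.{w} K A ⥤ FDRightComodule.{w'} K C) : Prop :=
  ∀ (X Y Z : FDRightModule.{w} K A) (f : X ⟶ Y) (g : Y ⟶ Z),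
    Function.Injective f.hom → Function.Exact f.hom g.hom → Function.Surjective g.hom →
      Function.Injective (RightComodule.Hom.toLinearMap (F.map f).hom) ∧
      Function.Exact (RightComodule.Hom.toLinearMap (F.map f).hom)
        (RightComodule.Hom.toLinearMap (F.map g).hom) ∧
      Function.Surjective (RightComodule.Hom.toLinearMap (F.map g).hom)

/-- A `K`-coalgebra `C` is of wild comodule type if there is an exact and faithful `K`-linear
functor from the category of finite dimensional right modules over the path algebra of the
quiver with three parallel arrows to the category of finite dimensional right `C`-comodules,
which respects isomorphism classes and carries indecomposables to indecomposables. -/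
def IsWildComoduleType.{u, v} (K : Type u) [Field K] (C : Type v) [AddCommGroup C] [Module K C]
    [Coalgebra K C] : Prop :=
  ∃ F : FDRightModule.{u} K (PathSpace K Kronecker₃) ⥤ FDRightComodule.{max u v} K C,
    F.Additive ∧ F.Linear K ∧ F.Faithful ∧ IsExactModToComod F ∧
    (∀ X Y, Nonempty (F.obj X ≅ F.obj Y) → Nonempty (X ≅ Y)) ∧
    ∀ X, IsIndecomposableObj X → IsIndecomposableObj (F.obj X)

/-!
The annihilator `Ω` of an admissible subcoalgebra `C` of `KQ` is a relation ideal, because the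
product of `KQ` is adjoint to its coproduct (`PathSpace.pairing_mul`). Let `C_{x,y}` be the part of
`C` spanned by paths from `x` to `y`. A finite dimensional subspace of `KQ` is its own double
annihilator, so if all `C_{x,y}` were finite dimensional, then `C` would equal `C(Q, Ω)`. Hence some
`C_{x,y}` is infinite dimensional (`PathSpace.exists_infinite_componentSubmodule`), and as `Q` is
acyclic, `x ≠ y`. Only three linearly independent elements `c₀, c₁, c₂` of `C_{x,y}` are needed.

Let `P` be the space of those elements of `C` which are combinations of final segments, starting
outside of `x`, of the paths occurring in the `c i`. It is a finite dimensional right coideal of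
`C`, and `θ i = Δ(c i) - c i ⊗ x` lies in `P ⊗ C` (`PathSpace.nonempty_kroneckerDatum`). A
representation `f₀, f₁, f₂ : M → N` of the Kronecker quiver is sent to `M × (N ⊗ P)` with coaction
`m ↦ m ⊗ x + ∑ i, f i m ⊗ θ i` on `M` and `n ⊗ p ↦ n ⊗ Δ(p)` on `N ⊗ P`. This construction is
linear and exact since tensoring over a field is.

It is also full and faithful (`KroneckerDatum.exists_eq_prodMap`). No element of `P` involves a path
starting in `x`, so a morphism respects the two summands. As `P` is a subcomodule of the injective
hull of the simple comodule at `y`, in which this simple comodule occurs once, a morphism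
`N ⊗ P → N' ⊗ P` comes from a linear map `N → N'`. Linear independence of the `θ i` yields the
compatibility with the arrows. A fully faithful functor reflects isomorphisms, and it preserves
indecomposability because idempotents split in the category of modules.
-/

universe u v w

/-! ### Pairing, product and coproduct on the path space -/

namespace PathSpace

section

variable {K : Type*} [Field K] {V : Type*} [Quiver V]

theorem counit_ofPath {a b : V} (p : Quiver.Path a b) :
    Coalgebra.counit (R := K) (ofPath K p) = if p.length = 0 then 1 else 0 :=
  counitLin_ofPath p

theorem comul_ofPath {a b : V} (p : Quiver.Path a b) :
    Coalgebra.comul (R := K) (ofPath K p) =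
      ((splits p).map fun s => ofPath K s.2.2 ⊗ₜ[K] ofPath K s.2.1).sum :=
  comulLin_ofPath p

theorem coeff_eq_coord (w : PathSpace K V) (p : PathIn V) :
    coeff w p = (pathBasis K V).coord p w := rfl

theorem sum_coeff_smul (w : PathSpace K V) :
    ∑ p ∈ ((pathBasis K V).repr w).support, coeff w p • ofPath K p.2.2 = w :=
  (pathBasis K V).linearCombination_repr w

open Classical in
theorem coeff_ofPath {a b : V} (p : Quiver.Path a b) (q : PathIn V) :
    coeff (ofPath K p) q = if (⟨a, b, p⟩ : PathIn V) = q then 1 else 0 := by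
  rw [coeff, ← pathBasis_mk, Module.Basis.repr_self, Finsupp.single_apply]

theorem pairing_ofPath_left {a b : V} (p : Quiver.Path a b) (w : PathSpace K V) :
    pairing K V (ofPath K p) w = coeff w ⟨a, b, p⟩ := by
  rw [pairing, ← pathBasis_mk, Module.Basis.constr_basis]
  rfl

open Classical in
theorem coeff_ofPath_comm {a b c d : V} (p : Quiver.Path a b) (q : Quiver.Path c d) :
    coeff (ofPath K p) ⟨c, d, q⟩ = coeff (ofPath K q) ⟨a, b, p⟩ := by
  rw [coeff_ofPath, coeff_ofPath]
  simp only [eq_comm]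

theorem pairing_comm (v w : PathSpace K V) : pairing K V v w = pairing K V w v := by
  suffices h : pairing K V = (pairing K V).flip from
    LinearMap.congr_fun (LinearMap.congr_fun h v) w
  refine hom_ext fun a b p => hom_ext fun c d q => ?_
  rw [LinearMap.flip_apply, pairing_ofPath_left, pairing_ofPath_left, coeff_ofPath_comm]

theorem pairing_ofPath_right {a b : V} (p : Quiver.Path a b) (w : PathSpace K V) :
    pairing K V w (ofPath K p) = coeff w ⟨a, b, p⟩ := by
  rw [pairing_comm, pairing_ofPath_left]

theorem induction_ofPath {P : PathSpace K V → Prop} (w : PathSpace K V) (zero : P 0)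
    (add : ∀ u v, P u → P v → P (u + v)) (smul : ∀ (c : K) u, P u → P (c • u))
    (path : ∀ (a b : V) (p : Quiver.Path a b), P (ofPath K p)) : P w := by
  have hw : w ∈ Submodule.span K (Set.range (pathBasis K V)) := by
    rw [(pathBasis K V).span_eq]
    trivial
  induction hw using Submodule.span_induction with
  | mem x hx =>
    obtain ⟨⟨a, b, p⟩, rfl⟩ := hx
    exact path a b p
  | zero => exact zero
  | add x y _ _ hx hy => exact add x y hx hy
  | smul c x _ hx => exact smul c x hx

/-- The product `u w` is a path or zero, and `(u, w)` is then one of the factorizations of that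
path; since `splits q` lists each factorization once, at most one term of the sum survives. -/
theorem pairing_ofPath_mul {e f c d a c' : V} (q : Quiver.Path e f) (u : Quiver.Path c d)
    (w : Quiver.Path a c') :
    pairing K V (ofPath K q) (ofPath K u * ofPath K w) =
      ((splits q).map fun s => pairing K V (ofPath K s.2.2) (ofPath K u) *
        pairing K V (ofPath K s.2.1) (ofPath K w)).sum := by
  classical
  have hz : (∀ s ∈ splits q, pairing K V (ofPath K s.2.2) (ofPath K u) *
        pairing K V (ofPath K s.2.1) (ofPath K w) = 0) →
      ((splits q).map fun s => pairing K V (ofPath K s.2.2) (ofPath K u) *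
        pairing K V (ofPath K s.2.1) (ofPath K w)).sum = 0 := by
    intro h
    refine List.sum_eq_zero fun x hx => ?_
    obtain ⟨s, hs, rfl⟩ := List.mem_map.1 hx
    exact h s hs
  simp only [pairing_ofPath_right, coeff_ofPath, ← ite_and, mul_ite, mul_one, mul_zero] at hz ⊢
  by_cases hc : c' = c
  · subst hc
    rw [ofPath_mul_ofPath, pairing_ofPath_right, coeff_ofPath]
    by_cases he : e = a
    · subst he
      by_cases hf : f = d
      · subst hf
        rw [← List.sum_toFinset _ (nodup_splits q)]
        have hs : ∀ s : Σ c : V, Quiver.Path e c × Quiver.Path c f,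
            ((⟨e, s.1, s.2.1⟩ : PathIn V) = ⟨e, c', w⟩ ∧
              (⟨s.1, f, s.2.2⟩ : PathIn V) = ⟨c', f, u⟩) ↔ s = ⟨c', w, u⟩ := by
          rintro ⟨k, τ, η⟩
          constructor
          · rintro ⟨h1, h2⟩
            cases h1
            cases h2
            rfl
          · intro h
            cases h
            exact ⟨rfl, rfl⟩
        simp only [hs, Finset.sum_ite_eq', List.mem_toFinset, mem_splits]
        refine if_congr ⟨fun h => ?_, fun h => ?_⟩ rfl rfl
        · cases h
          rfl
        · rw [h]
      · rw [hz, if_neg]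
        · intro h
          exact hf (congrArg (fun r : PathIn V => r.2.1) h)
        · rintro s -
          rw [if_neg]
          rintro ⟨-, h⟩
          exact hf (congrArg (fun r : PathIn V => r.2.1) h)
    · rw [hz, if_neg]
      · intro h
        exact he (congrArg (fun r : PathIn V => r.1) h)
      · rintro s -
        rw [if_neg]
        rintro ⟨h, -⟩
        exact he (congrArg (fun r : PathIn V => r.1) h)
  · rw [ofPath_mul_ofPath_of_ne _ _ hc, map_zero, hz]
    rintro s -
    rw [if_neg]
    rintro ⟨h1, h2⟩
    exact hc ((congrArg (fun r : PathIn V => r.2.1) h1).symm.trans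
      (congrArg (fun r : PathIn V => r.1) h2))

/-- The product of `KQ` is adjoint to its coproduct: `⟨x, u w⟩ = ⟨Δ x, u ⊗ w⟩`. This is what turns
the annihilator of a subcoalgebra into an ideal. -/
theorem pairing_mul (x u w : PathSpace K V) :
    pairing K V x (u * w) = LinearMap.mul' K K
      (TensorProduct.map ((pairing K V).flip u) ((pairing K V).flip w)
        (Coalgebra.comul (R := K) x)) := by
  simp only [← mulLin_apply]
  induction x using induction_ofPath with
  | zero => simp
  | add x y hx hy => simp only [map_add, LinearMap.add_apply, hx, hy]
  | smul c x hx => simp only [map_smul, LinearMap.smul_apply, hx]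
  | path e f q =>
    induction u using induction_ofPath with
    | zero => simp
    | add x y hx hy =>
      simp only [map_add, LinearMap.add_apply, hx, hy, TensorProduct.map_add_left]
    | smul c x hx => simp only [map_smul, LinearMap.smul_apply, hx, TensorProduct.map_smul_left]
    | path c d u =>
      induction w using induction_ofPath with
      | zero => simp
      | add x y hx hy =>
        simp only [map_add, LinearMap.add_apply, hx, hy, TensorProduct.map_add_right]
      | smul c x hx =>
        simp only [map_smul, LinearMap.smul_apply, hx, TensorProduct.map_smul_right]
      | path a c' w =>
        rw [mulLin_apply, pairing_ofPath_mul, comul_ofPath, map_list_sum, map_list_sum,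
          List.map_map, List.map_map]
        rfl

/-- The action `x ↦ (id ⊗ f) (Δ x)` of a functional `f` on `KQ` as a right comodule over itself. It
maps a path `η τ` to the combination of its final segments `η` with coefficients `f τ`. -/
noncomputable def stripRight (f : PathSpace K V →ₗ[K] K) : PathSpace K V →ₗ[K] PathSpace K V :=
  (TensorProduct.rid K _).toLinearMap ∘ₗ f.lTensor _ ∘ₗ Coalgebra.comul

/-- The action `x ↦ (f ⊗ id) (Δ x)` of a functional `f` on `KQ` as a left comodule over itself. It
maps a path `η τ` to the combination of its initial segments `τ` with coefficients `f η`. -/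
noncomputable def stripLeft (f : PathSpace K V →ₗ[K] K) : PathSpace K V →ₗ[K] PathSpace K V :=
  (TensorProduct.lid K _).toLinearMap ∘ₗ f.rTensor _ ∘ₗ Coalgebra.comul

theorem stripRight_ofPath (f : PathSpace K V →ₗ[K] K) {a b : V} (p : Quiver.Path a b) :
    stripRight f (ofPath K p) =
      ((splits p).map fun s => f (ofPath K s.2.1) • ofPath K s.2.2).sum := by
  simp only [stripRight, LinearMap.comp_apply, comul_ofPath, map_list_sum, List.map_map]
  rfl

theorem stripLeft_ofPath (f : PathSpace K V →ₗ[K] K) {a b : V} (p : Quiver.Path a b) :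
    stripLeft f (ofPath K p) =
      ((splits p).map fun s => f (ofPath K s.2.2) • ofPath K s.2.1).sum := by
  simp only [stripLeft, LinearMap.comp_apply, comul_ofPath, map_list_sum, List.map_map]
  rfl

/-- The coefficient of the trivial path at `v`. In the dual algebra of `KQ` it is the idempotent
belonging to `v`. -/
noncomputable def vertexCoeff (K : Type*) [Field K] {V : Type*} [Quiver V] (v : V) :
    PathSpace K V →ₗ[K] K :=
  (pathBasis K V).coord ⟨v, v, .nil⟩

open Classical in
theorem vertexCoeff_nil (v a : V) :
    vertexCoeff K v (ofPath K (.nil : Quiver.Path a a)) = if a = v then 1 else 0 := by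
  rw [vertexCoeff, ← coeff_eq_coord, coeff_ofPath]
  refine if_congr ⟨fun h => congrArg Sigma.fst h, ?_⟩ rfl rfl
  rintro rfl
  rfl

theorem vertexCoeff_cons (v : V) {a b c : V} (p : Quiver.Path a b) (α : b ⟶ c) :
    vertexCoeff K v (ofPath K (p.cons α)) = 0 := by
  classical
  rw [vertexCoeff, ← coeff_eq_coord, coeff_ofPath, if_neg]
  intro h
  cases h

open Classical in
/-- The idempotent at `v`, acting from the left, projects to the span of the paths ending in `v`. -/
theorem stripLeft_vertexCoeff (v : V) {a b : V} (p : Quiver.Path a b) :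
    stripLeft (vertexCoeff K v) (ofPath K p) = if b = v then ofPath K p else 0 := by
  rw [stripLeft_ofPath]
  cases p with
  | nil => simp [splits, vertexCoeff_nil]
  | cons p α =>
    rw [splits, List.map_cons, List.sum_cons, List.map_map, vertexCoeff_nil, List.sum_eq_zero]
    · simp
    · intro x hx
      obtain ⟨s, -, rfl⟩ := List.mem_map.1 hx
      simp only [Function.comp_apply, vertexCoeff_cons, zero_smul]

open Classical in
/-- The idempotent at `v`, acting from the right, projects to the span of the paths starting in
`v`. -/
theorem stripRight_vertexCoeff (v : V) {a b : V} (p : Quiver.Path a b) :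
    stripRight (vertexCoeff K v) (ofPath K p) = if a = v then ofPath K p else 0 := by
  induction p with
  | nil => simp [stripRight_ofPath, splits, vertexCoeff_nil]
  | @cons b c p α ih =>
    have h : stripRight (vertexCoeff K v) (ofPath K (p.cons α)) =
        mulLin K V (ofPath K α.toPath) (stripRight (vertexCoeff K v) (ofPath K p)) := by
      rw [stripRight_ofPath, stripRight_ofPath, splits, List.map_cons, List.sum_cons, List.map_map,
        vertexCoeff_cons, zero_smul, zero_add, map_list_sum, List.map_map]
      congr 2
      funext s
      simp only [Function.comp_apply, map_smul, mulLin_apply, ofPath_mul_ofPath]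
      rfl
    rw [h, ih]
    split_ifs
    · rw [mulLin_apply, ofPath_mul_ofPath]
      rfl
    · rw [map_zero]

end

/-! ### Components of a subcoalgebra and its annihilator -/

section

variable {K : Type*} [Field K] {V : Type*} [Quiver V]

theorem stripRight_mem (C : Subcoalgebra K (PathSpace K V)) (f : PathSpace K V →ₗ[K] K)
    {c : PathSpace K V} (hc : c ∈ C.toSubmodule) : stripRight f c ∈ C.toSubmodule := by
  obtain ⟨z, hz⟩ := C.comul_mem c hc
  rw [stripRight, LinearMap.comp_apply, LinearMap.comp_apply, ← hz]
  clear hz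
  induction z with
  | zero => simp
  | add x y hx hy =>
    simp only [map_add]
    exact C.toSubmodule.add_mem hx hy
  | tmul x y =>
    simpa using C.toSubmodule.smul_mem _ x.2

theorem stripLeft_mem (C : Subcoalgebra K (PathSpace K V)) (f : PathSpace K V →ₗ[K] K)
    {c : PathSpace K V} (hc : c ∈ C.toSubmodule) : stripLeft f c ∈ C.toSubmodule := by
  obtain ⟨z, hz⟩ := C.comul_mem c hc
  rw [stripLeft, LinearMap.comp_apply, LinearMap.comp_apply, ← hz]
  clear hz
  induction z with
  | zero => simp
  | add x y hx hy =>
    simp only [map_add]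
    exact C.toSubmodule.add_mem hx hy
  | tmul x y =>
    simpa using C.toSubmodule.smul_mem _ y.2

/-- The elements of `KQ` orthogonal to `C`. -/
noncomputable def annihilator (C : Submodule K (PathSpace K V)) : Submodule K (PathSpace K V) where
  carrier := {ω | ∀ a ∈ C, pairing K V a ω = 0}
  zero_mem' := fun a _ => by simp
  add_mem' := fun {u v} hu hv a ha => by simp [hu a ha, hv a ha]
  smul_mem' := fun c u hu a ha => by simp [hu a ha]

theorem isRelationIdeal_annihilator {C : Subcoalgebra K (PathSpace K V)} (hC : IsAdmissible C) :
    IsRelationIdeal (annihilator C.toSubmodule) := by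
  refine ⟨fun x ω hω => ⟨fun a ha => ?_, fun a ha => ?_⟩, fun ω hω p hp => ?_⟩
  · rw [pairing_mul]
    obtain ⟨z, hz⟩ := C.comul_mem a ha
    rw [← hz]
    clear hz
    induction z with
    | zero => simp
    | add x y hx hy => simp only [map_add, hx, hy, add_zero]
    | tmul c d => simp [hω d d.2]
  · rw [pairing_mul]
    obtain ⟨z, hz⟩ := C.comul_mem a ha
    rw [← hz]
    clear hz
    induction z with
    | zero => simp
    | add x y hx hy => simp only [map_add, hx, hy, add_zero]
    | tmul c d => simp [hω c c.2]
  · obtain ⟨a, b, p⟩ := p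
    by_contra hlt
    apply hp
    rw [← pairing_ofPath_left]
    apply hω
    cases p with
    | nil => exact hC.1 a
    | cons q α =>
      cases q with
      | nil => exact hC.2 _ _ α
      | cons r β =>
        simp only [Quiver.Path.length_cons] at hlt
        omega

/-- The projection of `KQ` onto the span of the paths from `x` to `y`. -/
noncomputable def component (K : Type*) [Field K] {V : Type*} [Quiver V] (x y : V) :
    PathSpace K V →ₗ[K] PathSpace K V :=
  stripLeft (vertexCoeff K y) ∘ₗ stripRight (vertexCoeff K x)

open Classical in
theorem component_ofPath (x y : V) {a b : V} (p : Quiver.Path a b) :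
    component K x y (ofPath K p) = if a = x ∧ b = y then ofPath K p else 0 := by
  rw [component, LinearMap.comp_apply, stripRight_vertexCoeff, ite_and]
  split_ifs with h h'
  · rw [stripLeft_vertexCoeff, if_pos h']
  · rw [stripLeft_vertexCoeff, if_neg h']
  · rw [map_zero]

/-- A subcoalgebra is stable under the projections because they are given by actions of
functionals. -/
theorem component_mem (C : Subcoalgebra K (PathSpace K V)) (x y : V) {c : PathSpace K V}
    (hc : c ∈ C.toSubmodule) : component K x y c ∈ C.toSubmodule :=
  stripLeft_mem C _ (stripRight_mem C _ hc)

theorem pairing_component (x y : V) (v w : PathSpace K V) :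
    pairing K V (component K x y v) w = pairing K V v (component K x y w) := by
  classical
  suffices h : pairing K V ∘ₗ component K x y = (pairing K V).compl₂ (component K x y) from
    LinearMap.congr_fun (LinearMap.congr_fun h v) w
  refine hom_ext fun a b p => hom_ext fun c d q => ?_
  rw [LinearMap.comp_apply, LinearMap.compl₂_apply, component_ofPath, component_ofPath]
  by_cases h : (⟨a, b, p⟩ : PathIn V) = ⟨c, d, q⟩
  · cases h
    split_ifs <;> simp
  · have : pairing K V (ofPath K p) (ofPath K q) = 0 := by
      rw [pairing_ofPath_right, coeff_ofPath, if_neg h]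
    split_ifs <;> simp [this]

theorem component_component (x y : V) (w : PathSpace K V) :
    component K x y (component K x y w) = component K x y w := by
  classical
  suffices h : component K x y ∘ₗ component K x y = component K x y from LinearMap.congr_fun h w
  refine hom_ext fun a b p => ?_
  rw [LinearMap.comp_apply, component_ofPath]
  split_ifs with h
  · rw [component_ofPath, if_pos h]
  · rw [map_zero]

theorem mem_of_forall_component_mem (C : Submodule K (PathSpace K V)) {w : PathSpace K V}
    (h : ∀ x y, component K x y w ∈ C) : w ∈ C := by
  classical
  have key : ∑ q ∈ ((pathBasis K V).repr w).support.image (fun p => (p.1, p.2.1)),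
      component K q.1 q.2 w = w := by
    conv_rhs => rw [← sum_coeff_smul w]
    rw [← Finset.sum_fiberwise_of_maps_to (g := fun p : PathIn V => (p.1, p.2.1))
      (fun p hp => Finset.mem_image_of_mem _ hp)]
    refine Finset.sum_congr rfl fun q _ => ?_
    conv_lhs => rw [← sum_coeff_smul w]
    rw [map_sum, Finset.sum_filter]
    refine Finset.sum_congr rfl fun p _ => ?_
    rw [map_smul, component_ofPath, smul_ite, smul_zero]
    exact if_congr Prod.mk_inj.symm rfl rfl
  rw [← key]
  exact Submodule.sum_mem _ fun q _ => h _ _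

/-- On a finite dimensional subspace of `KQ` every functional is represented by an element of `KQ`;
on all of `KQ` this fails, as elements of `KQ` have finite support. -/
theorem exists_pairing_eq (F : Submodule K (PathSpace K V)) [FiniteDimensional K F]
    (f : PathSpace K V →ₗ[K] K) : ∃ w, ∀ v ∈ F, pairing K V v w = f v := by
  classical
  obtain ⟨s, hs⟩ := (Module.Finite.iff_fg (N := F)).1 inferInstance
  let T := s.biUnion fun v => ((pathBasis K V).repr v).support
  refine ⟨∑ p ∈ T, f (ofPath K p.2.2) • ofPath K p.2.2, fun v hv => ?_⟩
  rw [← hs] at hv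
  induction hv using Submodule.span_induction with
  | zero => simp
  | add x y _ _ hx hy => rw [map_add, LinearMap.add_apply, hx, hy, map_add]
  | smul c x _ hx => rw [map_smul, LinearMap.smul_apply, hx, map_smul]
  | mem v hv =>
    rw [map_sum]
    conv_rhs => rw [← sum_coeff_smul v, map_sum]
    symm
    refine Finset.sum_subset_zero_on_sdiff ?_ ?_ ?_
    · exact Finset.subset_biUnion_of_mem (fun v => ((pathBasis K V).repr v).support) hv
    · intro p hp
      rw [map_smul, pairing_ofPath_right]
      have : coeff v p = 0 := by
        simpa [coeff] using (Finset.mem_sdiff.1 hp).2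
      change _ • coeff v p = 0
      rw [this, smul_zero]
    · intro p _
      rw [map_smul, map_smul, pairing_ofPath_right, smul_eq_mul, smul_eq_mul, mul_comm]

/-- The elements of `C` that are combinations of paths from `x` to `y`. -/
noncomputable def componentSubmodule (C : Submodule K (PathSpace K V)) (x y : V) :
    Submodule K (PathSpace K V) :=
  C ⊓ LinearMap.eqLocus (component K x y) LinearMap.id

/-- If all components `C_{x,y}` are finite dimensional, then each of them is its own double
annihilator, so that `C = C(Q, C^⊥)`. Hence some component of `C` is infinite dimensional. -/
theorem exists_infinite_componentSubmodule {C : Subcoalgebra K (PathSpace K V)}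
    (hC : IsAdmissible C) (hrel : ¬ IsPathCoalgebraOfRelations C) :
    ∃ x y, ¬ FiniteDimensional K (componentSubmodule C.toSubmodule x y) := by
  by_contra! hfin
  refine hrel ⟨annihilator C.toSubmodule, isRelationIdeal_annihilator hC, le_antisymm ?_ ?_⟩
  · exact fun a ha ω hω => hω a ha
  · intro a ha
    refine mem_of_forall_component_mem _ fun x y => ?_
    by_contra hxy
    have hF : component K x y a ∉ componentSubmodule C.toSubmodule x y := fun h => hxy h.1
    -- A functional that separates the component of `a` from `C_{x,y}` is represented by some `w`;
    -- the component of `w` then annihilates `C` but not `a`.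
    obtain ⟨f, hfa, hf⟩ := Submodule.exists_le_ker_of_notMem hF
    have := hfin x y
    obtain ⟨w, hw⟩ := exists_pairing_eq
      (componentSubmodule C.toSubmodule x y ⊔ K ∙ component K x y a) f
    apply hfa
    rw [← hw _ (Submodule.mem_sup_right (Submodule.mem_span_singleton_self _)), pairing_component]
    refine ha _ fun c hc => ?_
    have hc' : component K x y c ∈ componentSubmodule C.toSubmodule x y :=
      ⟨component_mem C x y hc, component_component x y c⟩
    rw [← pairing_component, hw _ (Submodule.mem_sup_left hc')]
    exact hf hc'

end

end PathSpace

/-! ### Comodules attached to Kronecker representations -/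

/-- The data from which representations of the three arrow Kronecker quiver are turned into
comodules over `C`: a finite dimensional comodule `P`, a grouplike element `g`, and three linearly
independent cocycles `θ i` describing extensions of the one dimensional comodule of `g` by `P`.
The functional `eg` acts as the projection to the `g`-part of such an extension, `eh` maps `P` onto
the line of `h`, with coefficient `aug`, and `P` embeds into the cofree comodule `C` along `aug`. -/
structure KroneckerDatum (K : Type u) [Field K] (C : Type v) [AddCommGroup C] [Module K C]
    [Coalgebra K C] where
  P : RightComodule.{v} K C
  finite : FiniteDimensional K P.carrier
  g : C
  comul_g : Coalgebra.comul (R := K) g = g ⊗ₜ[K] g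
  counit_g : Coalgebra.counit (R := K) g = 1
  θ : Fin 3 → P.carrier ⊗[K] C
  /-- Coassociativity of the coaction `1 ↦ 1 ⊗ g + θ i` on the extension `K × P`. -/
  cocycle : ∀ i, (Coalgebra.comul (R := K)).lTensor P.carrier (θ i) =
    TensorProduct.assoc K P.carrier C C (θ i ⊗ₜ[K] g) +
      TensorProduct.assoc K P.carrier C C (P.coact.rTensor C (θ i))
  counit_θ : ∀ i, (Coalgebra.counit (R := K)).lTensor P.carrier (θ i) = 0
  linearIndependent : LinearIndependent K θ
  eg : C →ₗ[K] K
  eg_g : eg g = 1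
  eg_coact : ∀ p, eg.lTensor P.carrier (P.coact p) = 0
  eg_θ : ∀ i, eg.lTensor P.carrier (θ i) = 0
  eh : C →ₗ[K] K
  h : P.carrier
  aug : P.carrier →ₗ[K] K
  aug_h : aug h = 1
  eh_coact : ∀ p, eh.lTensor P.carrier (P.coact p) = h ⊗ₜ[K] aug p
  injective_aug : Function.Injective (aug.rTensor C ∘ₗ P.coact)

namespace KroneckerDatum

variable {K : Type u} [Field K] {C : Type v} [AddCommGroup C] [Module K C] [Coalgebra K C]
variable (D : KroneckerDatum K C)

section Extension

variable {M N : Type w} [AddCommGroup M] [Module K M] [AddCommGroup N] [Module K N]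

/-- The inclusion of `N ⊗ P` as second summand of `M × (N ⊗ P)`, tensored with `E`; the source is
bracketed so that coactions of `P` can be inserted. -/
noncomputable def inclTensor (M N : Type w) [AddCommGroup M] [Module K M] [AddCommGroup N]
    [Module K N] (E : Type*) [AddCommGroup E] [Module K E] :
    N ⊗[K] (D.P.carrier ⊗[K] E) →ₗ[K] (M × (N ⊗[K] D.P.carrier)) ⊗[K] E :=
  (LinearMap.inr K M (N ⊗[K] D.P.carrier)).rTensor E ∘ₗ
    (TensorProduct.assoc K N D.P.carrier E).symm.toLinearMap

theorem inclTensor_tmul {E : Type*} [AddCommGroup E] [Module K E] (n : N) (p : D.P.carrier)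
    (e : E) : D.inclTensor M N E (n ⊗ₜ (p ⊗ₜ e)) = ((0 : M), n ⊗ₜ[K] p) ⊗ₜ[K] e := by
  simp [inclTensor]

theorem lTensor_inclTensor {E E' : Type*} [AddCommGroup E] [Module K E] [AddCommGroup E']
    [Module K E'] (φ : E →ₗ[K] E') (z : N ⊗[K] (D.P.carrier ⊗[K] E)) :
    φ.lTensor _ (D.inclTensor M N E z) =
      D.inclTensor M N E' ((φ.lTensor D.P.carrier).lTensor N z) := by
  suffices h : φ.lTensor _ ∘ₗ D.inclTensor M N E =
      D.inclTensor M N E' ∘ₗ (φ.lTensor D.P.carrier).lTensor N from LinearMap.congr_fun h z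
  refine TensorProduct.ext_threefold' ?_
  intro n p e
  simp [inclTensor_tmul]

/-- The coaction on `M × (N ⊗ P)` given by `m ↦ m ⊗ g + ∑ i, f i m ⊗ θ i` on `M` and by the
coaction of `P` on `N ⊗ P`. -/
noncomputable def extCoact (f : Fin 3 → M →ₗ[K] N) :
    M × (N ⊗[K] D.P.carrier) →ₗ[K] (M × (N ⊗[K] D.P.carrier)) ⊗[K] C :=
  LinearMap.coprod
    ((TensorProduct.mk K _ C).flip D.g ∘ₗ LinearMap.inl K M _ +
      D.inclTensor M N C ∘ₗ ∑ i, (TensorProduct.mk K N _).flip (D.θ i) ∘ₗ f i)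
    (D.inclTensor M N C ∘ₗ D.P.coact.lTensor N)

theorem extCoact_inl (f : Fin 3 → M →ₗ[K] N) (m : M) :
    D.extCoact f (m, 0) = (m, (0 : N ⊗[K] D.P.carrier)) ⊗ₜ[K] D.g +
      ∑ i, D.inclTensor M N C (f i m ⊗ₜ D.θ i) := by
  simp [extCoact]

theorem extCoact_inr (f : Fin 3 → M →ₗ[K] N) (z : N ⊗[K] D.P.carrier) :
    D.extCoact f (0, z) = D.inclTensor M N C (D.P.coact.lTensor N z) := by
  simp [extCoact, Prod.mk_zero_zero]

theorem assoc_inclTensor_tmul (n : N) (t : D.P.carrier ⊗[K] C) (c : C) :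
    TensorProduct.assoc K _ C C (D.inclTensor M N C (n ⊗ₜ t) ⊗ₜ[K] c) =
      D.inclTensor M N (C ⊗[K] C) (n ⊗ₜ TensorProduct.assoc K _ C C (t ⊗ₜ c)) := by
  induction t with
  | zero => simp
  | add x y hx hy => simp only [TensorProduct.tmul_add, map_add, TensorProduct.add_tmul, hx, hy]
  | tmul p e => simp [inclTensor_tmul]

theorem assoc_rTensor_extCoact_inclTensor (f : Fin 3 → M →ₗ[K] N) (n : N)
    (t : D.P.carrier ⊗[K] C) :
    TensorProduct.assoc K _ C C ((D.extCoact f).rTensor C (D.inclTensor M N C (n ⊗ₜ t))) =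
      D.inclTensor M N (C ⊗[K] C)
        (n ⊗ₜ TensorProduct.assoc K _ C C (D.P.coact.rTensor C t)) := by
  induction t with
  | zero => simp
  | add x y hx hy => simp only [TensorProduct.tmul_add, map_add, hx, hy]
  | tmul p e =>
    rw [inclTensor_tmul, LinearMap.rTensor_tmul, extCoact_inr, LinearMap.lTensor_tmul,
      assoc_inclTensor_tmul, LinearMap.rTensor_tmul]

/-- The comodule `M × (N ⊗ P)` attached to linear maps `f i : M → N`. -/
noncomputable def extComodule (f : Fin 3 → M →ₗ[K] N) : RightComodule.{max v w} K C where
  carrier := M × (N ⊗[K] D.P.carrier)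
  coact := D.extCoact f
  coassoc := by
    refine LinearMap.prod_ext (LinearMap.ext fun m => ?_) (TensorProduct.ext' fun n p => ?_)
    · simp only [LinearMap.comp_apply, LinearMap.inl_apply, LinearEquiv.coe_coe, extCoact_inl,
        map_add, map_sum, LinearMap.rTensor_tmul, assoc_rTensor_extCoact_inclTensor,
        TensorProduct.add_tmul, TensorProduct.sum_tmul, lTensor_inclTensor, LinearMap.lTensor_tmul,
        cocycle, D.comul_g, TensorProduct.tmul_add, assoc_inclTensor_tmul,
        TensorProduct.assoc_tmul, Finset.sum_add_distrib]
      abel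
    · have := LinearMap.congr_fun D.P.coassoc p
      simp only [LinearMap.comp_apply, LinearEquiv.coe_coe] at this
      simp only [LinearMap.comp_apply, LinearMap.inr_apply, LinearEquiv.coe_coe, extCoact_inr,
        LinearMap.lTensor_tmul, assoc_rTensor_extCoact_inclTensor, lTensor_inclTensor, this]
  counit := by
    refine LinearMap.prod_ext (LinearMap.ext fun m => ?_) (TensorProduct.ext' fun n p => ?_)
    · simp [extCoact_inl, lTensor_inclTensor, counit_θ, D.counit_g]
    · have := LinearMap.congr_fun D.P.counit p
      simp only [LinearMap.comp_apply, LinearEquiv.coe_coe, LinearMap.id_apply] at this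
      rw [← LinearEquiv.eq_symm_apply, TensorProduct.rid_symm_apply] at this
      simp [extCoact_inr, lTensor_inclTensor, this, inclTensor_tmul]


end Extension

section Maps

variable {M N M' N' : Type w} [AddCommGroup M] [Module K M] [AddCommGroup N] [Module K N]
  [AddCommGroup M'] [Module K M'] [AddCommGroup N'] [Module K N']

theorem rTensor_inclTensor {E : Type*} [AddCommGroup E] [Module K E] (a : M →ₗ[K] M')
    (b : N →ₗ[K] N') (z : N ⊗[K] (D.P.carrier ⊗[K] E)) :
    (a.prodMap (b.rTensor D.P.carrier)).rTensor E (D.inclTensor M N E z) =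
      D.inclTensor M' N' E (b.rTensor _ z) := by
  suffices h : (a.prodMap (b.rTensor D.P.carrier)).rTensor E ∘ₗ D.inclTensor M N E =
      D.inclTensor M' N' E ∘ₗ b.rTensor _ from LinearMap.congr_fun h z
  refine TensorProduct.ext_threefold' ?_
  intro n p e
  simp [inclTensor_tmul]

/-- A morphism of representations `(M, N, f) → (M', N', f')` induces a morphism of comodules. -/
theorem extCoact_comp_prodMap (f : Fin 3 → M →ₗ[K] N) (f' : Fin 3 → M' →ₗ[K] N')
    (a : M →ₗ[K] M') (b : N →ₗ[K] N') (hab : ∀ i m, b (f i m) = f' i (a m)) :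
    D.extCoact f' ∘ₗ a.prodMap (b.rTensor D.P.carrier) =
      (a.prodMap (b.rTensor D.P.carrier)).rTensor C ∘ₗ D.extCoact f := by
  refine LinearMap.prod_ext (LinearMap.ext fun m => ?_) (TensorProduct.ext' fun n p => ?_)
  · simp [extCoact_inl, rTensor_inclTensor, hab]
  · simp [extCoact_inr, rTensor_inclTensor]

theorem inclTensor_injective {E : Type*} [AddCommGroup E] [Module K E] :
    Function.Injective (D.inclTensor M N E) := by
  refine Function.Injective.comp (g := (LinearMap.inr K M (N ⊗[K] D.P.carrier)).rTensor E) ?_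
    (TensorProduct.assoc K N D.P.carrier E).symm.injective
  exact Module.Flat.rTensor_preserves_injective_linearMap _ LinearMap.inr_injective

theorem eg_extCoact (f : Fin 3 → M →ₗ[K] N) (x : M × (N ⊗[K] D.P.carrier)) :
    D.eg.lTensor _ (D.extCoact f x) = (x.1, (0 : N ⊗[K] D.P.carrier)) ⊗ₜ[K] (1 : K) := by
  suffices h : D.eg.lTensor _ ∘ₗ D.extCoact f = (TensorProduct.mk K _ K).flip 1 ∘ₗ
      LinearMap.inl K M _ ∘ₗ LinearMap.fst K M (N ⊗[K] D.P.carrier) from LinearMap.congr_fun h x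
  refine LinearMap.prod_ext (LinearMap.ext fun m => ?_) (TensorProduct.ext' fun n p => ?_)
  · simp [extCoact_inl, lTensor_inclTensor, eg_θ, eg_g]
  · simp [extCoact_inr, lTensor_inclTensor, eg_coact, Prod.mk_zero_zero]

theorem eh_extCoact (f : Fin 3 → M →ₗ[K] N) (n : N) (p : D.P.carrier) :
    D.eh.lTensor _ (D.extCoact f (0, n ⊗ₜ p)) = ((0 : M), n ⊗ₜ[K] D.h) ⊗ₜ[K] D.aug p := by
  simp [extCoact_inr, lTensor_inclTensor, eh_coact, inclTensor_tmul]

/-- A comodule map `ψ : N ⊗ P → N' ⊗ P` is determined by its composite with `aug`, because `P`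
embeds into a cofree comodule along `aug`. -/
theorem eq_rTensor_of_coact_comp (ψ : N ⊗[K] D.P.carrier →ₗ[K] N' ⊗[K] D.P.carrier)
    (b : N →ₗ[K] N')
    (hψ : ∀ z, D.P.coact.lTensor N' (ψ z) = TensorProduct.assoc K _ _ _
      (ψ.rTensor C ((TensorProduct.assoc K _ _ _).symm (D.P.coact.lTensor N z))))
    (hb : ∀ n p, TensorProduct.rid K N' (D.aug.lTensor N' (ψ (n ⊗ₜ p))) = D.aug p • b n) :
    ψ = b.rTensor D.P.carrier := by
  refine TensorProduct.ext' fun n p => ?_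
  have hinj : Function.Injective ((D.aug.rTensor C ∘ₗ D.P.coact).lTensor N') :=
    Module.Flat.lTensor_preserves_injective_linearMap _ D.injective_aug
  apply hinj
  rw [LinearMap.lTensor_comp, LinearMap.comp_apply, LinearMap.comp_apply, hψ,
    LinearMap.lTensor_tmul, LinearMap.rTensor_tmul, LinearMap.lTensor_tmul]
  generalize D.P.coact p = t
  induction t with
  | zero => simp
  | add x y hx hy => simp only [map_add, TensorProduct.tmul_add, hx, hy]
  | tmul q c =>
    have h4 : ∀ z : N' ⊗[K] D.P.carrier, (D.aug.rTensor C).lTensor N'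
        (TensorProduct.assoc K _ _ _ (z ⊗ₜ[K] c)) =
        TensorProduct.rid K N' (D.aug.lTensor N' z) ⊗ₜ ((1 : K) ⊗ₜ c) := by
      intro z
      induction z with
      | zero => simp
      | add x y hx hy => simp only [map_add, TensorProduct.add_tmul, hx, hy]
      | tmul n p =>
        rw [TensorProduct.assoc_tmul, LinearMap.lTensor_tmul, LinearMap.rTensor_tmul,
          LinearMap.lTensor_tmul, TensorProduct.rid_tmul, TensorProduct.smul_tmul,
          TensorProduct.smul_tmul', smul_eq_mul, mul_one]
    rw [TensorProduct.assoc_symm_tmul, LinearMap.rTensor_tmul, h4, hb, LinearMap.lTensor_tmul,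
      LinearMap.rTensor_tmul, TensorProduct.smul_tmul, TensorProduct.smul_tmul', smul_eq_mul,
      mul_one]

/-- Compatibility with the action of `eh` forces the composite of `ψ` with `aug` to factor through
`aug`. -/
theorem rid_aug_of_extCoact_comp (f : Fin 3 → M →ₗ[K] N) (f' : Fin 3 → M' →ₗ[K] N')
    (φ : M × (N ⊗[K] D.P.carrier) →ₗ[K] M' × (N' ⊗[K] D.P.carrier))
    (hcomm : ∀ x, D.eh.lTensor _ (D.extCoact f' (φ x)) =
      φ.rTensor K (D.eh.lTensor _ (D.extCoact f x)))
    (ψ : N ⊗[K] D.P.carrier →ₗ[K] N' ⊗[K] D.P.carrier) (hψ : ∀ z, φ (0, z) = (0, ψ z)) (n : N)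
    (p : D.P.carrier) :
    TensorProduct.rid K N' (D.aug.lTensor N' (ψ (n ⊗ₜ p))) =
      D.aug p • TensorProduct.rid K N' (D.aug.lTensor N' (ψ (n ⊗ₜ D.h))) := by
  have h1 : ∀ z : N' ⊗[K] D.P.carrier, D.eh.lTensor _ (D.extCoact f' (0, z)) =
      ((0 : M'), TensorProduct.rid K N' (D.aug.lTensor N' z) ⊗ₜ[K] D.h) ⊗ₜ[K] (1 : K) := by
    intro z
    induction z with
    | zero => simp [Prod.mk_zero_zero]
    | add x y hx hy =>
      have : ((0 : M'), x + y) = (0, x) + (0, y) := by simp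
      rw [this, map_add, map_add, hx, hy, ← TensorProduct.add_tmul]
      simp [TensorProduct.add_tmul]
    | tmul n p =>
      rw [eh_extCoact, LinearMap.lTensor_tmul, TensorProduct.rid_tmul, ← TensorProduct.smul_tmul',
        ← smul_zero (D.aug p), ← Prod.smul_mk, TensorProduct.smul_tmul, smul_eq_mul, mul_one]
      simp
  have h2 := hcomm (0, n ⊗ₜ p)
  rw [hψ, h1, eh_extCoact, LinearMap.rTensor_tmul, hψ] at h2
  have h3 := congrArg (fun t => TensorProduct.rid K N' (D.aug.lTensor N'
    (TensorProduct.rid K _ t).2)) h2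
  simpa [D.aug_h] using h3

theorem eq_zero_of_sum_tmul_eq_zero {E ι : Type*} [Fintype ι] [AddCommGroup E] [Module K E]
    {t : ι → E} (ht : LinearIndependent K t) (n : ι → N) (h : ∑ i, n i ⊗ₜ[K] t i = 0) (i : ι) :
    n i = 0 := by
  classical
  obtain ⟨r, hr⟩ := LinearMap.exists_leftInverse_of_injective (Fintype.linearCombination K t)
    (LinearMap.ker_eq_bot.2 (ht.fintypeLinearCombination_injective))
  have hrt : ∀ j, r (t j) = Pi.single j 1 := by
    intro j
    have := LinearMap.congr_fun hr (Pi.single j 1)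
    simpa [Fintype.linearCombination_apply_single] using this
  have h1 := congrArg (fun z => TensorProduct.rid K N ((LinearMap.proj i ∘ₗ r).lTensor N z)) h
  simpa [hrt, Pi.single_apply] using h1

/-- Every comodule map between the extensions is induced by a morphism of representations: the
action of `eg` makes it diagonal, the one of `eh` makes it a pure tensor on `N ⊗ P`, and the linear
independence of the cocycles gives the compatibility with the maps `f i`. -/
theorem exists_eq_prodMap (f : Fin 3 → M →ₗ[K] N) (f' : Fin 3 → M' →ₗ[K] N')
    (φ : M × (N ⊗[K] D.P.carrier) →ₗ[K] M' × (N' ⊗[K] D.P.carrier))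
    (hφ : D.extCoact f' ∘ₗ φ = φ.rTensor C ∘ₗ D.extCoact f) :
    ∃ (a : M →ₗ[K] M') (b : N →ₗ[K] N'), (∀ i m, b (f i m) = f' i (a m)) ∧
      φ = a.prodMap (b.rTensor D.P.carrier) := by
  have hφ' : ∀ x, D.extCoact f' (φ x) = φ.rTensor C (D.extCoact f x) := LinearMap.congr_fun hφ
  have hcomm : ∀ (e : C →ₗ[K] K) x, e.lTensor _ (D.extCoact f' (φ x)) =
      φ.rTensor K (e.lTensor _ (D.extCoact f x)) := by
    intro e x
    rw [hφ', ← LinearMap.comp_apply, ← LinearMap.comp_apply (φ.rTensor K),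
      LinearMap.lTensor_comp_rTensor, LinearMap.rTensor_comp_lTensor]
  have hfst : ∀ x, φ (x.1, 0) = ((φ x).1, 0) := by
    intro x
    have := hcomm D.eg x
    rw [eg_extCoact, eg_extCoact, LinearMap.rTensor_tmul] at this
    simpa using (congrArg (TensorProduct.rid K _) this).symm
  let a : M →ₗ[K] M' := LinearMap.fst K _ _ ∘ₗ φ ∘ₗ LinearMap.inl K _ _
  let ψ : N ⊗[K] D.P.carrier →ₗ[K] N' ⊗[K] D.P.carrier :=
    LinearMap.snd K _ _ ∘ₗ φ ∘ₗ LinearMap.inr K _ _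
  have hψr : ∀ z, φ (0, z) = (0, ψ z) := by
    intro z
    have := hfst (0, z)
    rw [Prod.mk_zero_zero, map_zero] at this
    exact Prod.ext (congrArg Prod.fst this).symm rfl
  have hdiag : φ = a.prodMap ψ := by
    refine LinearMap.prod_ext (LinearMap.ext fun m => ?_) (LinearMap.ext fun z => ?_)
    · simpa [a] using hfst (m, 0)
    · simpa using hψr z
  have hψ : ∀ z, D.P.coact.lTensor N' (ψ z) = TensorProduct.assoc K _ _ _
      (ψ.rTensor C ((TensorProduct.assoc K _ _ _).symm (D.P.coact.lTensor N z))) := by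
    intro z
    apply D.inclTensor_injective (M := M')
    rw [← D.extCoact_inr f', ← hψr, hφ', extCoact_inr]
    generalize D.P.coact.lTensor N z = t
    suffices h : φ.rTensor C ∘ₗ D.inclTensor M N C = D.inclTensor M' N' C ∘ₗ
        (TensorProduct.assoc K _ _ _).toLinearMap ∘ₗ ψ.rTensor C ∘ₗ
          (TensorProduct.assoc K _ _ _).symm.toLinearMap from LinearMap.congr_fun h t
    refine TensorProduct.ext_threefold' ?_
    intro n p c
    simp [inclTensor, hψr]
  let b : N →ₗ[K] N' := TensorProduct.rid K N' ∘ₗ D.aug.lTensor N' ∘ₗ ψ ∘ₗ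
    (TensorProduct.mk K N _).flip D.h
  have hψb : ψ = b.rTensor D.P.carrier := D.eq_rTensor_of_coact_comp ψ b hψ
    (D.rid_aug_of_extCoact_comp f f' φ (hcomm D.eh) ψ hψr)
  refine ⟨a, b, ?_, by rw [hdiag, hψb]⟩
  intro i m
  have h5 := hφ' (m, 0)
  rw [hdiag, hψb, extCoact_inl, map_add, map_sum, LinearMap.prodMap_apply, map_zero, extCoact_inl]
    at h5
  simp only [rTensor_inclTensor, LinearMap.rTensor_tmul, LinearMap.prodMap_apply, map_zero,
    add_right_inj, ← map_sum] at h5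
  have h6 := D.inclTensor_injective h5
  refine sub_eq_zero.1 (eq_zero_of_sum_tmul_eq_zero D.linearIndependent
    (fun i => b (f i m) - f' i (a m)) ?_ i)
  simp only [TensorProduct.sub_tmul, Finset.sum_sub_distrib, h6, sub_self]

end Maps

end KroneckerDatum

/-! ### Idempotents and indecomposable objects -/

section Indecomposable

variable {𝒞 𝒟 : Type*} [Category 𝒞] [Preadditive 𝒞] [Category 𝒟] [Preadditive 𝒟]

theorem IsIndecomposableObj.idempotent_eq_zero_or_one [IsIdempotentComplete 𝒞] {X : 𝒞}
    (hX : IsIndecomposableObj X) (p : X ⟶ X) (hp : p ≫ p = p) : p = 0 ∨ p = 𝟙 X := by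
  obtain ⟨Y, i, e, hie, hei⟩ := IsIdempotentComplete.idempotents_split X p hp
  obtain ⟨Z, i', e', hie', hei'⟩ := IsIdempotentComplete.idempotents_split X (𝟙 X - p)
    (Idempotents.idem_of_id_sub_idem p hp)
  have hp' : p ≫ (𝟙 X - p) = 0 := by simp [hp]
  have hp'' : (𝟙 X - p) ≫ p = 0 := by simp [hp]
  have hi : i ≫ p = i := by rw [← hei, reassoc_of% hie]
  have hi' : i' ≫ (𝟙 X - p) = i' := by rw [← hei', reassoc_of% hie']
  have he : p ≫ e = e := by rw [← hei, Category.assoc, hie, Category.comp_id]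
  have he' : (𝟙 X - p) ≫ e' = e' := by rw [← hei', Category.assoc, hie', Category.comp_id]
  let b : Limits.BinaryBicone Y Z :=
    { pt := X
      fst := e
      snd := e'
      inl := i
      inr := i'
      inl_fst := hie
      inr_snd := hie'
      inl_snd := by
        rw [← hi, ← he', Category.assoc, reassoc_of% hp', Limits.zero_comp, Limits.comp_zero]
      inr_fst := by
        rw [← hi', ← he, Category.assoc, reassoc_of% hp'', Limits.zero_comp, Limits.comp_zero] }
  have hb : b.IsBilimit := Limits.isBinaryBilimitOfTotal b (by
    change e ≫ i + e' ≫ i' = 𝟙 X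
    rw [hei, hei', add_sub_cancel])
  rcases hX.2 Y Z b ⟨hb⟩ ⟨Iso.refl X⟩ with h | h
  · left
    rw [← hei, h.eq_of_tgt e 0, Limits.zero_comp]
  · right
    rw [h.eq_of_tgt e' 0, Limits.zero_comp] at hei'
    exact (sub_eq_zero.1 hei'.symm).symm

/-- A fully faithful functor keeps the idempotent endomorphisms, and an object is decomposable
precisely when it has an idempotent endomorphism other than zero and the identity. -/
theorem IsIndecomposableObj.of_fullyFaithful [IsIdempotentComplete 𝒞] (F : 𝒞 ⥤ 𝒟) [F.Additive]
    [F.Full] [F.Faithful] {X : 𝒞} (hX : IsIndecomposableObj X) :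
    IsIndecomposableObj (F.obj X) := by
  refine ⟨fun h => hX.1 ?_, ?_⟩
  · rw [Limits.IsZero.iff_id_eq_zero] at h ⊢
    apply F.map_injective
    rw [F.map_id, h, F.map_zero]
  · rintro Y Z b ⟨-⟩ ⟨φ⟩
    obtain ⟨p, hp⟩ := F.map_surjective (φ.hom ≫ b.fst ≫ b.inl ≫ φ.inv)
    have hpp : p ≫ p = p := F.map_injective (by simp [hp])
    rcases hX.idempotent_eq_zero_or_one p hpp with h | h
    · left
      rw [h, F.map_zero] at hp
      rw [Limits.IsZero.iff_id_eq_zero]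
      have : b.inl ≫ φ.inv ≫ (φ.hom ≫ b.fst ≫ b.inl ≫ φ.inv) ≫ φ.hom ≫ b.fst = 𝟙 Y := by simp
      rw [← this, ← hp]
      simp
    · right
      rw [h, F.map_id] at hp
      rw [Limits.IsZero.iff_id_eq_zero]
      have : b.inr ≫ φ.inv ≫ (φ.hom ≫ b.fst ≫ b.inl ≫ φ.inv) ≫ φ.hom ≫ b.snd = 0 := by simp
      rw [← hp] at this
      simpa using this

end Indecomposable

open scoped ModuleCat

instance FDRightModule.isIdempotentComplete (K : Type u) [Field K] (A : Type v) [Ring A]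
    [Algebra K A] : IsIdempotentComplete (FDRightModule.{w} K A) where
  idempotents_split X p hp := by
    have hp' : ∀ x, p.hom.hom (p.hom.hom x) = p.hom.hom x := fun x =>
      LinearMap.congr_fun (congrArg (fun q : X ⟶ X => q.hom.hom) hp) x
    have hX : FiniteDimensional K X.obj := X.property
    let Y : ModuleCat.{w} Aᵐᵒᵖ := ModuleCat.of Aᵐᵒᵖ (LinearMap.range p.hom.hom)
    let π : X.obj ⟶ Y := ModuleCat.ofHom p.hom.hom.rangeRestrict
    let ι : Y ⟶ X.obj := ModuleCat.ofHom (LinearMap.range p.hom.hom).subtype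
    have hY : FiniteDimensional K Y := Module.Finite.of_surjective
      (π.hom.restrictScalars K) p.hom.hom.surjective_rangeRestrict
    refine ⟨⟨Y, hY⟩, ObjectProperty.homMk ι, ObjectProperty.homMk π, ?_, ?_⟩
    · refine ObjectProperty.hom_ext _ (ModuleCat.hom_ext (LinearMap.ext ?_))
      rintro ⟨_, y, rfl⟩
      exact Subtype.ext (hp' y)
    · rfl

/-! ### Right modules over the Kronecker algebra -/

namespace Kronecker₃

open PathSpace

/-- The trivial path at a vertex. -/
noncomputable abbrev vertex (K : Type u) [Field K] (v : Kronecker₃) : PathSpace K Kronecker₃ :=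
  ofPath K (.nil : Quiver.Path v v)

/-- The `i`-th arrow, as an element of the path algebra. -/
noncomputable abbrev arrow (K : Type u) [Field K] (i : Fin 3) : PathSpace K Kronecker₃ :=
  ofPath K (Quiver.Hom.toPath (Arrow.arr i : source ⟶ sink))

theorem one_eq (K : Type u) [Field K] :
    (1 : PathSpace K Kronecker₃) = vertex K source + vertex K sink := by
  change ∑ v : Kronecker₃, ofPath K (Quiver.Path.nil : Quiver.Path v v) = _
  rw [show (Finset.univ : Finset Kronecker₃) = {source, sink} from rfl,
    Finset.sum_pair (by decide)]

theorem vertex_mul_self (K : Type u) [Field K] (v : Kronecker₃) :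
    vertex K v * vertex K v = vertex K v := ofPath_mul_ofPath _ _

theorem vertex_mul_vertex_of_ne (K : Type u) [Field K] {v w : Kronecker₃} (h : w ≠ v) :
    vertex K v * vertex K w = 0 := ofPath_mul_ofPath_of_ne _ _ h

theorem arrow_mul_source (K : Type u) [Field K] (i : Fin 3) :
    arrow K i * vertex K source = arrow K i := ofPath_mul_ofPath _ _

theorem sink_mul_arrow (K : Type u) [Field K] (i : Fin 3) :
    vertex K sink * arrow K i = arrow K i := ofPath_mul_ofPath _ _

theorem ofPath_eq_vertex_or_arrow (K : Type u) [Field K] {a b : Kronecker₃}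
    (p : Quiver.Path a b) :
    (∃ v, ofPath K p = vertex K v) ∨ ∃ i, ofPath K p = arrow K i := by
  cases p with
  | nil => exact Or.inl ⟨a, rfl⟩
  | cons q α =>
    change Arrow _ _ at α
    cases α with
    | arr i =>
      cases q with
      | nil => exact Or.inr ⟨i, rfl⟩
      | cons _ β =>
        change Arrow _ _ at β
        cases β

variable {K : Type u} [Field K]
variable {X Y : Type w} [AddCommGroup X] [Module (PathSpace K Kronecker₃)ᵐᵒᵖ X] [Module K X]
  [IsScalarTower K (PathSpace K Kronecker₃)ᵐᵒᵖ X] [AddCommGroup Y]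
  [Module (PathSpace K Kronecker₃)ᵐᵒᵖ Y] [Module K Y]
  [IsScalarTower K (PathSpace K Kronecker₃)ᵐᵒᵖ Y]

open MulOpposite

/-- The subspace `X e_v` of a right module `X`, for the trivial path `e_v`. -/
noncomputable def vertexSpace (K : Type u) [Field K] (X : Type w) [AddCommGroup X]
    [Module (PathSpace K Kronecker₃)ᵐᵒᵖ X] [Module K X]
    [IsScalarTower K (PathSpace K Kronecker₃)ᵐᵒᵖ X] (v : Kronecker₃) : Submodule K X :=
  LinearMap.eqLocus (Algebra.lsmul K K X (op (vertex K v))) LinearMap.id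

theorem mem_vertexSpace {v : Kronecker₃} {x : X} :
    x ∈ vertexSpace K X v ↔ op (vertex K v) • x = x := Iff.rfl

/-- Right multiplication by the `i`-th arrow. As products are read from right to left, it goes from
the sink to the source. -/
noncomputable def arrowMap (K : Type u) [Field K] (X : Type w) [AddCommGroup X]
    [Module (PathSpace K Kronecker₃)ᵐᵒᵖ X] [Module K X]
    [IsScalarTower K (PathSpace K Kronecker₃)ᵐᵒᵖ X] (i : Fin 3) :
    vertexSpace K X sink →ₗ[K] vertexSpace K X source :=
  (Algebra.lsmul K K X (op (arrow K i))).restrict fun x _ => by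
    rw [mem_vertexSpace, Algebra.lsmul_coe, smul_smul, ← MulOpposite.op_mul, arrow_mul_source]

/-- The projection `x ↦ x e_v`. -/
noncomputable def vertexProj (K : Type u) [Field K] (X : Type w) [AddCommGroup X]
    [Module (PathSpace K Kronecker₃)ᵐᵒᵖ X] [Module K X]
    [IsScalarTower K (PathSpace K Kronecker₃)ᵐᵒᵖ X] (v : Kronecker₃) :
    X →ₗ[K] vertexSpace K X v :=
  (Algebra.lsmul K K X (op (vertex K v))).codRestrict _ fun x => by
    rw [mem_vertexSpace, Algebra.lsmul_coe, smul_smul, ← MulOpposite.op_mul, vertex_mul_self]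

theorem coe_vertexProj (v : Kronecker₃) (x : X) :
    (vertexProj K X v x : X) = op (vertex K v) • x := rfl

theorem vertexProj_add (x : X) :
    (vertexProj K X source x : X) + (vertexProj K X sink x : X) = x := by
  rw [coe_vertexProj, coe_vertexProj, ← add_smul, ← MulOpposite.op_add, ← one_eq,
    MulOpposite.op_one, one_smul]

theorem vertexProj_coe (v : Kronecker₃) (x : vertexSpace K X v) : vertexProj K X v x = x :=
  Subtype.ext x.2

theorem vertex_smul_coe (v : Kronecker₃) (x : vertexSpace K X v) :
    op (vertex K v) • (x : X) = x := x.2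

theorem vertex_smul_coe_of_ne {v w : Kronecker₃} (h : v ≠ w) (x : vertexSpace K X v) :
    op (vertex K w) • (x : X) = 0 := by
  rw [← vertex_smul_coe v x, smul_smul, ← MulOpposite.op_mul, vertex_mul_vertex_of_ne K h.symm,
    MulOpposite.op_zero, zero_smul]

theorem vertexProj_coe_of_ne {v w : Kronecker₃} (h : v ≠ w) (x : vertexSpace K X v) :
    vertexProj K X w x = 0 := Subtype.ext (vertex_smul_coe_of_ne h x)

theorem vertexProj_vertex_smul (v : Kronecker₃) (x : X) :
    vertexProj K X v (op (vertex K v) • x) = vertexProj K X v x :=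
  vertexProj_coe v (vertexProj K X v x)

theorem vertexProj_vertex_smul_of_ne {v w : Kronecker₃} (h : v ≠ w) (x : X) :
    vertexProj K X w (op (vertex K v) • x) = 0 :=
  vertexProj_coe_of_ne h (vertexProj K X v x)

theorem arrow_smul_source (i : Fin 3) (x : vertexSpace K X source) :
    op (arrow K i) • (x : X) = 0 := by
  rw [← vertex_smul_coe source x, smul_smul, ← MulOpposite.op_mul,
    ofPath_mul_ofPath_of_ne _ _ (by decide), MulOpposite.op_zero, zero_smul]

theorem arrow_smul (i : Fin 3) (x : X) :
    op (arrow K i) • x = (arrowMap K X i (vertexProj K X sink x) : X) := by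
  change _ = op (arrow K i) • op (vertex K sink) • x
  rw [smul_smul, ← MulOpposite.op_mul, sink_mul_arrow]

theorem vertexProj_source_arrow_smul (i : Fin 3) (x : X) :
    vertexProj K X source (op (arrow K i) • x) = arrowMap K X i (vertexProj K X sink x) := by
  rw [arrow_smul, vertexProj_coe]

theorem vertexProj_sink_arrow_smul (i : Fin 3) (x : X) :
    vertexProj K X sink (op (arrow K i) • x) = 0 := by
  rw [arrow_smul, vertexProj_coe_of_ne (by decide)]

/-- The linear map `X e_v → Y e_v` induced by a module homomorphism. -/
noncomputable def vertexMap (φ : X →ₗ[(PathSpace K Kronecker₃)ᵐᵒᵖ] Y) (v : Kronecker₃) :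
    vertexSpace K X v →ₗ[K] vertexSpace K Y v :=
  (φ.restrictScalars K).restrict fun x hx => by
    rw [mem_vertexSpace] at hx ⊢
    rw [LinearMap.restrictScalars_apply, ← map_smul, hx]

theorem coe_vertexMap (φ : X →ₗ[(PathSpace K Kronecker₃)ᵐᵒᵖ] Y) (v : Kronecker₃)
    (x : vertexSpace K X v) : (vertexMap φ v x : Y) = φ x := rfl

theorem vertexMap_arrowMap (φ : X →ₗ[(PathSpace K Kronecker₃)ᵐᵒᵖ] Y) (i : Fin 3)
    (x : vertexSpace K X sink) :
    vertexMap φ source (arrowMap K X i x) = arrowMap K Y i (vertexMap φ sink x) :=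
  Subtype.ext (map_smul φ _ _)

theorem hom_ext_vertexMap {φ ψ : X →ₗ[(PathSpace K Kronecker₃)ᵐᵒᵖ] Y}
    (h : ∀ v, vertexMap φ v = vertexMap ψ v) : φ = ψ := by
  refine LinearMap.ext fun x => ?_
  rw [← vertexProj_add (K := K) x, map_add, map_add, ← coe_vertexMap, ← coe_vertexMap, h, h]
  rfl

/-- The path algebra is spanned by two trivial paths and three arrows, so compatibility with the
arrow maps suffices for linearity over it. -/
theorem exists_vertexMap_eq (a : vertexSpace K X sink →ₗ[K] vertexSpace K Y sink)
    (b : vertexSpace K X source →ₗ[K] vertexSpace K Y source)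
    (hab : ∀ i x, b (arrowMap K X i x) = arrowMap K Y i (a x)) :
    ∃ φ : X →ₗ[(PathSpace K Kronecker₃)ᵐᵒᵖ] Y, vertexMap φ sink = a ∧ vertexMap φ source = b := by
  let φ₀ : X →ₗ[K] Y := (vertexSpace K Y sink).subtype ∘ₗ a ∘ₗ vertexProj K X sink +
    (vertexSpace K Y source).subtype ∘ₗ b ∘ₗ vertexProj K X source
  have hφ₀ : ∀ x, φ₀ x = a (vertexProj K X sink x) + b (vertexProj K X source x) := fun _ => rfl
  have hsmul : ∀ (r : PathSpace K Kronecker₃) (x : X), φ₀ (op r • x) = op r • φ₀ x := by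
    intro r x
    suffices h : φ₀ ∘ₗ (Algebra.lsmul K K X).toLinearMap.flip x ∘ₗ
          (MulOpposite.opLinearEquiv K).toLinearMap =
        (Algebra.lsmul K K Y).toLinearMap.flip (φ₀ x) ∘ₗ
          (MulOpposite.opLinearEquiv K).toLinearMap from LinearMap.congr_fun h r
    refine hom_ext fun v w p => ?_
    change φ₀ (op (ofPath K p) • x) = op (ofPath K p) • φ₀ x
    rw [hφ₀, hφ₀, smul_add]
    rcases ofPath_eq_vertex_or_arrow K p with ⟨_ | _, h⟩ | ⟨i, h⟩
    · rw [h, vertexProj_vertex_smul, vertexProj_vertex_smul_of_ne (by decide),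
        vertex_smul_coe, vertex_smul_coe_of_ne (by decide), map_zero, ZeroMemClass.coe_zero]
    · rw [h, vertexProj_vertex_smul, vertexProj_vertex_smul_of_ne (by decide),
        vertex_smul_coe, vertex_smul_coe_of_ne (by decide), map_zero, ZeroMemClass.coe_zero]
    · rw [h, vertexProj_sink_arrow_smul, vertexProj_source_arrow_smul, hab, arrow_smul_source,
        map_zero, ZeroMemClass.coe_zero, zero_add, add_zero]
      rfl
  refine ⟨{ φ₀ with map_smul' := fun r x => hsmul r.unop x }, ?_, ?_⟩
  · refine LinearMap.ext fun x => Subtype.ext ?_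
    change φ₀ x = _
    rw [hφ₀, vertexProj_coe, vertexProj_coe_of_ne (by decide), map_zero, ZeroMemClass.coe_zero,
      add_zero]
  · refine LinearMap.ext fun x => Subtype.ext ?_
    change φ₀ x = _
    rw [hφ₀, vertexProj_coe, vertexProj_coe_of_ne (by decide), map_zero, ZeroMemClass.coe_zero,
      zero_add]

theorem vertexMap_exact {Z : Type w} [AddCommGroup Z] [Module (PathSpace K Kronecker₃)ᵐᵒᵖ Z]
    [Module K Z] [IsScalarTower K (PathSpace K Kronecker₃)ᵐᵒᵖ Z]
    {φ : X →ₗ[(PathSpace K Kronecker₃)ᵐᵒᵖ] Y} {ψ : Y →ₗ[(PathSpace K Kronecker₃)ᵐᵒᵖ] Z}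
    (h : Function.Exact φ ψ) (v : Kronecker₃) :
    Function.Exact (vertexMap φ v) (vertexMap ψ v) := by
  intro y
  constructor
  · intro hy
    obtain ⟨x, hx⟩ := (h y).1 (congrArg Subtype.val hy)
    refine ⟨vertexProj K X v x, Subtype.ext ?_⟩
    rw [coe_vertexMap, coe_vertexProj, map_smul, hx]
    exact y.2
  · rintro ⟨x, rfl⟩
    exact Subtype.ext ((h _).2 ⟨x, rfl⟩)

theorem vertexMap_injective {φ : X →ₗ[(PathSpace K Kronecker₃)ᵐᵒᵖ] Y}
    (h : Function.Injective φ) (v : Kronecker₃) : Function.Injective (vertexMap φ v) :=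
  fun _ _ hxy => Subtype.ext (h (congrArg Subtype.val hxy))

theorem vertexMap_surjective {φ : X →ₗ[(PathSpace K Kronecker₃)ᵐᵒᵖ] Y}
    (h : Function.Surjective φ) (v : Kronecker₃) : Function.Surjective (vertexMap φ v) := by
  intro y
  obtain ⟨x, hx⟩ := h y
  refine ⟨vertexProj K X v x, Subtype.ext ?_⟩
  rw [coe_vertexMap, coe_vertexProj, map_smul, hx]
  exact y.2

end Kronecker₃

/-! ### The functor from modules to comodules -/

namespace KroneckerDatum

open Kronecker₃

variable {K : Type u} [Field K] {C : Type v} [AddCommGroup C] [Module K C] [Coalgebra K C]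

/-- The functor `X ↦ X e_sink × (X e_source ⊗ P)` from modules over the Kronecker algebra to
comodules. -/
noncomputable def functor (D : KroneckerDatum K C) :
    FDRightModule.{u} K (PathSpace K Kronecker₃) ⥤ FDRightComodule.{max u v} K C where
  obj X := ⟨D.extComodule (arrowMap K X.obj), by
    have := D.finite
    have : FiniteDimensional K X.obj := X.property
    exact inferInstanceAs (FiniteDimensional K
      (vertexSpace K X.obj sink × (vertexSpace K X.obj source ⊗[K] D.P.carrier)))⟩
  map {X Y} φ := ObjectProperty.homMk ⟨(vertexMap φ.hom.hom sink).prodMap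
      ((vertexMap φ.hom.hom source).rTensor D.P.carrier),
    D.extCoact_comp_prodMap _ _ _ _ (vertexMap_arrowMap φ.hom.hom)⟩
  map_id X := by
    refine ObjectProperty.hom_ext _ (Subtype.ext ?_)
    change LinearMap.prodMap LinearMap.id (LinearMap.rTensor D.P.carrier LinearMap.id) =
      LinearMap.id
    rw [LinearMap.rTensor_id, LinearMap.prodMap_id]
  map_comp {X Y Z} φ ψ := by
    refine ObjectProperty.hom_ext _ (Subtype.ext ?_)
    change LinearMap.prodMap (vertexMap ψ.hom.hom sink ∘ₗ vertexMap φ.hom.hom sink)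
      (LinearMap.rTensor D.P.carrier
        (vertexMap ψ.hom.hom source ∘ₗ vertexMap φ.hom.hom source)) = _
    rw [LinearMap.rTensor_comp, ← LinearMap.prodMap_comp]
    rfl

variable (D : KroneckerDatum K C)

theorem functor_map {X Y : FDRightModule.{u} K (PathSpace K Kronecker₃)} (φ : X ⟶ Y) :
    RightComodule.Hom.toLinearMap (D.functor.map φ).hom =
      (vertexMap φ.hom.hom sink).prodMap
        ((vertexMap φ.hom.hom source).rTensor D.P.carrier) := rfl

theorem functor_additive : D.functor.Additive where
  map_add {X Y φ ψ} := by
    refine ObjectProperty.hom_ext _ (Subtype.ext ?_)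
    change LinearMap.prodMap (vertexMap φ.hom.hom sink + vertexMap ψ.hom.hom sink)
      (LinearMap.rTensor D.P.carrier
        (vertexMap φ.hom.hom source + vertexMap ψ.hom.hom source)) = _
    rw [LinearMap.rTensor_add, LinearMap.prodMap_add]
    rfl

theorem functor_linear : D.functor.Linear K where
  map_smul {X Y} φ c := by
    refine ObjectProperty.hom_ext _ (Subtype.ext ?_)
    change LinearMap.prodMap (c • vertexMap φ.hom.hom sink)
      (LinearMap.rTensor D.P.carrier (c • vertexMap φ.hom.hom source)) = _
    rw [LinearMap.rTensor_smul, LinearMap.prodMap_smul]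
    rfl

theorem functor_full : D.functor.Full where
  map_surjective {X Y} ψ := by
    obtain ⟨a, b, hab, h⟩ := D.exists_eq_prodMap (arrowMap K X.obj) (arrowMap K Y.obj)
      (RightComodule.Hom.toLinearMap ψ.hom) (Subtype.property ψ.hom)
    obtain ⟨φ, rfl, rfl⟩ := exists_vertexMap_eq a b hab
    exact ⟨ObjectProperty.homMk (ModuleCat.ofHom φ), ObjectProperty.hom_ext _ (Subtype.ext h.symm)⟩

theorem rTensor_injective {N N' : Type w} [AddCommGroup N] [Module K N] [AddCommGroup N']
    [Module K N'] {b b' : N →ₗ[K] N'} (h : b.rTensor D.P.carrier = b'.rTensor D.P.carrier) :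
    b = b' := by
  refine LinearMap.ext fun n => ?_
  have := congrArg (fun z => TensorProduct.rid K N' (D.aug.lTensor N' z))
    (LinearMap.congr_fun h (n ⊗ₜ D.h))
  simpa [D.aug_h] using this

theorem functor_faithful : D.functor.Faithful where
  map_injective {X Y φ ψ} h := by
    have h' : (vertexMap φ.hom.hom sink).prodMap
        ((vertexMap φ.hom.hom source).rTensor D.P.carrier) = (vertexMap ψ.hom.hom sink).prodMap
        ((vertexMap ψ.hom.hom source).rTensor D.P.carrier) :=
      congrArg (fun q : D.functor.obj X ⟶ D.functor.obj Y => RightComodule.Hom.toLinearMap q.hom) h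
    refine ObjectProperty.hom_ext _ (ModuleCat.hom_ext (hom_ext_vertexMap (K := K) ?_))
    rintro (_ | _)
    · refine D.rTensor_injective (LinearMap.ext fun z => ?_)
      exact congrArg Prod.snd (LinearMap.congr_fun h' (0, z))
    · refine LinearMap.ext fun m => ?_
      exact congrArg Prod.fst (LinearMap.congr_fun h' (m, 0))

theorem functor_exact : IsExactModToComod D.functor := by
  intro X Y Z φ ψ hφ hφψ hψ
  rw [functor_map, functor_map]
  refine ⟨?_, ?_, ?_⟩
  · exact (vertexMap_injective hφ sink).prodMap
      (Module.Flat.rTensor_preserves_injective_linearMap _ (vertexMap_injective hφ source))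
  · rintro ⟨y₁, y₂⟩
    have h₁ := vertexMap_exact (K := K) hφψ sink y₁
    have h₂ := Module.Flat.rTensor_exact D.P.carrier (vertexMap_exact (K := K) hφψ source) y₂
    refine (Prod.mk_eq_zero (M := vertexSpace K Z.obj sink)
      (N := vertexSpace K Z.obj source ⊗[K] D.P.carrier)).trans ((and_congr h₁ h₂).trans ?_)
    constructor
    · rintro ⟨⟨x₁, h₁⟩, x₂, h₂⟩
      exact ⟨(x₁, x₂), Prod.ext h₁ h₂⟩
    · rintro ⟨⟨x₁, x₂⟩, h⟩
      exact ⟨⟨x₁, congrArg Prod.fst h⟩, x₂, congrArg Prod.snd h⟩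
  · exact (vertexMap_surjective hψ sink).prodMap
      (LinearMap.rTensor_surjective _ (vertexMap_surjective hψ source))

theorem isWildComoduleType (D : KroneckerDatum K C) : IsWildComoduleType K C := by
  have := D.functor_additive
  have := D.functor_full
  have := D.functor_faithful
  refine ⟨D.functor, D.functor_additive, D.functor_linear, D.functor_faithful, D.functor_exact,
    ?_, ?_⟩
  · rintro X Y ⟨e⟩
    exact ⟨D.functor.preimageIso e⟩
  · intro X hX
    exact hX.of_fullyFaithful D.functor

end KroneckerDatum

/-! ### Right coideals and cocycles -/

/-- A tensor lies in `P ⊗ E'` if all its slices by functionals on `E'` lie in `P`. -/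
theorem Submodule.mem_range_rTensor_of_forall {K E E' : Type*} [Field K] [AddCommGroup E]
    [Module K E] [AddCommGroup E'] [Module K E'] (P : Submodule K E) (t : E ⊗[K] E')
    (h : ∀ f : E' →ₗ[K] K, TensorProduct.rid K E (f.lTensor E t) ∈ P) :
    t ∈ LinearMap.range (P.subtype.rTensor E') := by
  have hex := rTensor_exact E' (LinearMap.exact_subtype_mkQ P) P.mkQ_surjective
  refine (hex t).1 ?_
  classical
  let B := Module.Basis.ofVectorSpace K E'
  have key : ∀ (z : (E ⧸ P) ⊗[K] E'),
      (∀ f : E' →ₗ[K] K, TensorProduct.rid K (E ⧸ P) (f.lTensor _ z) = 0) → z = 0 := by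
    intro z hz
    apply (TensorProduct.equivFinsuppOfBasisRight B).injective
    rw [map_zero]
    ext i
    have : ∀ z : (E ⧸ P) ⊗[K] E', TensorProduct.equivFinsuppOfBasisRight B z i =
        TensorProduct.rid K (E ⧸ P) ((B.coord i).lTensor _ z) := by
      intro z
      induction z with
      | zero => simp
      | add x y hx hy => simp only [map_add, Finsupp.add_apply, hx, hy]
      | tmul x y => simp
    rw [this, hz, Finsupp.zero_apply]
  refine key _ fun f => ?_
  have : ∀ t : E ⊗[K] E', TensorProduct.rid K (E ⧸ P) (f.lTensor _ (P.mkQ.rTensor E' t)) =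
      P.mkQ (TensorProduct.rid K E (f.lTensor E t)) := by
    intro t
    induction t with
    | zero => simp
    | add x y hx hy => simp only [map_add, hx, hy]
    | tmul x y => simp
  rw [this]
  exact (Submodule.Quotient.mk_eq_zero P).2 (h f)

section

variable {K : Type u} [Field K] {C : Type v} [AddCommGroup C] [Module K C] [Coalgebra K C]

theorem Submodule.rTensor_subtype_injective {K A : Type*} [Field K] [AddCommGroup A] [Module K A]
    (P : Submodule K A) (E : Type*) [AddCommGroup E] [Module K E] :
    Function.Injective (P.subtype.rTensor E) :=
  Module.Flat.rTensor_preserves_injective_linearMap _ P.injective_subtype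

/-- The comultiplication of `C`, restricted to a subspace `P` with `Δ(P) ⊆ P ⊗ C`. -/
noncomputable def RightComodule.restrictCoact (P : Submodule K C)
    (hP : ∀ p ∈ P, Coalgebra.comul (R := K) p ∈ LinearMap.range (P.subtype.rTensor C)) :
    P →ₗ[K] P ⊗[K] C :=
  (LinearEquiv.ofInjective _ (P.rTensor_subtype_injective C)).symm.toLinearMap ∘ₗ
    (Coalgebra.comul (R := K) ∘ₗ P.subtype).codRestrict _ fun p => hP p p.2

theorem RightComodule.rTensor_restrictCoact (P : Submodule K C)
    (hP : ∀ p ∈ P, Coalgebra.comul (R := K) p ∈ LinearMap.range (P.subtype.rTensor C)) (p : P) :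
    P.subtype.rTensor C (restrictCoact P hP p) = Coalgebra.comul (R := K) (p : C) :=
  congrArg Subtype.val (LinearEquiv.apply_symm_apply
    (LinearEquiv.ofInjective _ (P.rTensor_subtype_injective C))
    ((Coalgebra.comul (R := K) ∘ₗ P.subtype).codRestrict _ (fun p => hP p p.2) p))

theorem RightComodule.rTensor_assoc_rTensor_restrictCoact (P : Submodule K C)
    (hP : ∀ p ∈ P, Coalgebra.comul (R := K) p ∈ LinearMap.range (P.subtype.rTensor C))
    (t : P ⊗[K] C) :
    P.subtype.rTensor (C ⊗[K] C) (TensorProduct.assoc K _ _ _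
        ((restrictCoact P hP).rTensor C t)) =
      TensorProduct.assoc K _ _ _ ((Coalgebra.comul (R := K)).rTensor C (P.subtype.rTensor C t)) := by
  have h : ∀ z : (P ⊗[K] C) ⊗[K] C, P.subtype.rTensor (C ⊗[K] C) (TensorProduct.assoc K _ _ _ z) =
      TensorProduct.assoc K _ _ _ ((P.subtype.rTensor C).rTensor C z) := by
    intro z
    rw [← LinearEquiv.coe_coe, ← LinearEquiv.coe_coe, ← LinearMap.comp_apply,
      ← LinearMap.comp_apply]
    congr 1
    exact TensorProduct.ext_threefold fun _ _ _ => rfl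
  rw [h, ← LinearMap.comp_apply, ← LinearMap.comp_apply, ← LinearMap.rTensor_comp,
    ← LinearMap.rTensor_comp]
  congr 2
  congr 1
  exact LinearMap.ext (rTensor_restrictCoact P hP)

theorem LinearMap.rTensor_lTensor_comm {K E E' F F' : Type*} [Field K] [AddCommGroup E]
    [Module K E] [AddCommGroup E'] [Module K E'] [AddCommGroup F] [Module K F] [AddCommGroup F']
    [Module K F'] (f : E →ₗ[K] E') (g : F →ₗ[K] F') (t : E ⊗[K] F) :
    f.rTensor F' (g.lTensor E t) = g.lTensor E' (f.rTensor F t) := by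
  rw [← LinearMap.comp_apply, ← LinearMap.comp_apply, LinearMap.rTensor_comp_lTensor,
    LinearMap.lTensor_comp_rTensor]

/-- A subspace `P` of `C` with `Δ(P) ⊆ P ⊗ C`, as a right comodule. -/
noncomputable def RightComodule.ofSubmodule (P : Submodule K C)
    (hP : ∀ p ∈ P, Coalgebra.comul (R := K) p ∈ LinearMap.range (P.subtype.rTensor C)) :
    RightComodule.{v} K C where
  carrier := P
  coact := restrictCoact P hP
  coassoc := by
    refine LinearMap.ext fun p => P.rTensor_subtype_injective _ ?_
    rw [LinearMap.comp_apply, LinearMap.comp_apply, LinearMap.comp_apply, LinearEquiv.coe_coe,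
      rTensor_assoc_rTensor_restrictCoact, rTensor_restrictCoact, LinearMap.rTensor_lTensor_comm,
      rTensor_restrictCoact, Coalgebra.coassoc_apply]
  counit := by
    refine LinearMap.ext fun p => ?_
    rw [LinearMap.comp_apply, LinearMap.comp_apply, LinearEquiv.coe_coe, LinearMap.id_apply,
      ← LinearEquiv.eq_symm_apply]
    apply P.rTensor_subtype_injective
    rw [LinearMap.rTensor_lTensor_comm, rTensor_restrictCoact, Coalgebra.lTensor_counit_comul]
    simp

theorem RightComodule.lTensor_restrictCoact (P : Submodule K C)
    (hP : ∀ p ∈ P, Coalgebra.comul (R := K) p ∈ LinearMap.range (P.subtype.rTensor C))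
    {E : Type*} [AddCommGroup E] [Module K E] (f : C →ₗ[K] E) (p : P) :
    P.subtype.rTensor E (f.lTensor P (restrictCoact P hP p)) =
      f.lTensor C (Coalgebra.comul (R := K) (p : C)) := by
  rw [LinearMap.rTensor_lTensor_comm, rTensor_restrictCoact]

theorem RightComodule.lTensor_comul_eq_of_rTensor_eq (P : Submodule K C)
    (hP : ∀ p ∈ P, Coalgebra.comul (R := K) p ∈ LinearMap.range (P.subtype.rTensor C))
    {g c : C} (hg : Coalgebra.comul (R := K) g = g ⊗ₜ[K] g) {θ : P ⊗[K] C}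
    (hθ : P.subtype.rTensor C θ = Coalgebra.comul (R := K) c - c ⊗ₜ[K] g) :
    (Coalgebra.comul (R := K)).lTensor P θ = TensorProduct.assoc K P C C (θ ⊗ₜ[K] g) +
      TensorProduct.assoc K P C C ((restrictCoact P hP).rTensor C θ) := by
  apply P.rTensor_subtype_injective
  have h1 : ∀ t : P ⊗[K] C, P.subtype.rTensor (C ⊗[K] C)
      (TensorProduct.assoc K _ _ _ (t ⊗ₜ[K] g)) =
      TensorProduct.assoc K _ _ _ (P.subtype.rTensor C t ⊗ₜ[K] g) := by
    intro t
    induction t with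
    | zero => simp
    | add x y hx hy => simp only [map_add, TensorProduct.add_tmul, hx, hy]
    | tmul x y => rfl
  rw [map_add, rTensor_assoc_rTensor_restrictCoact, h1, LinearMap.rTensor_lTensor_comm, hθ, map_sub,
    map_sub, map_sub, ← Coalgebra.coassoc_apply, LinearMap.lTensor_tmul, hg,
    TensorProduct.sub_tmul, map_sub, LinearMap.rTensor_tmul, TensorProduct.assoc_tmul]
  abel

theorem RightComodule.rTensor_counit_restrictCoact_injective (P : Submodule K C)
    (hP : ∀ p ∈ P, Coalgebra.comul (R := K) p ∈ LinearMap.range (P.subtype.rTensor C)) :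
    Function.Injective
      ((Coalgebra.counit (R := K) ∘ₗ P.subtype).rTensor C ∘ₗ restrictCoact P hP) := by
  have h1 : ∀ p : P, TensorProduct.lid K C (((Coalgebra.counit (R := K) ∘ₗ P.subtype).rTensor C)
      (RightComodule.restrictCoact P hP p)) = p := by
    intro p
    rw [LinearMap.rTensor_comp, LinearMap.comp_apply, RightComodule.rTensor_restrictCoact,
      Coalgebra.rTensor_counit_comul, TensorProduct.lid_tmul, one_smul]
  intro p q hpq
  apply Subtype.ext
  rw [← h1 p, ← h1 q]
  exact congrArg _ hpq

/-- The counit recovers `c i` from the cocycle `Δ(c i) - c i ⊗ g`. -/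
theorem linearIndependent_of_rTensor_eq (P : Submodule K C) {ι : Type*} {g : C} {c : ι → C}
    (hc : LinearIndependent K c) (hc0 : ∀ i, Coalgebra.counit (R := K) (c i) = 0)
    {θ : ι → P ⊗[K] C}
    (hθ : ∀ i, P.subtype.rTensor C (θ i) = Coalgebra.comul (R := K) (c i) - c i ⊗ₜ[K] g) :
    LinearIndependent K θ := by
  refine LinearIndependent.of_comp ((TensorProduct.lid K C).toLinearMap ∘ₗ
    (Coalgebra.counit (R := K)).rTensor C ∘ₗ P.subtype.rTensor C) ?_
  convert hc using 1
  funext i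
  rw [Function.comp_apply, LinearMap.comp_apply, LinearMap.comp_apply, hθ, map_sub,
    Coalgebra.rTensor_counit_comul, LinearMap.rTensor_tmul, hc0]
  simp

theorem Submodule.lTensor_eq_zero_of_rTensor_eq (P : Submodule K C) {g c : C} {θ : P ⊗[K] C}
    (hθ : P.subtype.rTensor C θ = Coalgebra.comul (R := K) c - c ⊗ₜ[K] g) (f : C →ₗ[K] K)
    (hg : f g = 1) (hc : f.lTensor C (Coalgebra.comul (R := K) c) = c ⊗ₜ[K] 1) :
    f.lTensor P θ = 0 := by
  apply P.rTensor_subtype_injective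
  rw [LinearMap.rTensor_lTensor_comm, hθ, map_sub, hc, LinearMap.lTensor_tmul, hg, sub_self,
    map_zero]

/-- The datum defined by a right coideal `P` and three elements `c i` of `C` which span
one dimensional comodules of type `g` modulo `P`: the cocycles are `θ i = Δ(c i) - c i ⊗ g`. Such a
cocycle is a coboundary in `C`, though not in `P`. -/
noncomputable def KroneckerDatum.ofSubmodule (P : Submodule K C) [hfin : FiniteDimensional K P]
    (hP : ∀ p ∈ P, Coalgebra.comul (R := K) p ∈ LinearMap.range (P.subtype.rTensor C))
    (g h : C) (hg : Coalgebra.comul (R := K) g = g ⊗ₜ[K] g)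
    (hg1 : Coalgebra.counit (R := K) g = 1) (hhP : h ∈ P) (hh1 : Coalgebra.counit (R := K) h = 1)
    (c : Fin 3 → C) (hc : LinearIndependent K c) (hc0 : ∀ i, Coalgebra.counit (R := K) (c i) = 0)
    (θ : Fin 3 → P ⊗[K] C)
    (hθ : ∀ i, P.subtype.rTensor C (θ i) = Coalgebra.comul (R := K) (c i) - c i ⊗ₜ[K] g)
    (eg eh : C →ₗ[K] K) (egg : eg g = 1)
    (egP : ∀ p ∈ P, eg.lTensor C (Coalgebra.comul (R := K) p) = 0)
    (egc : ∀ i, eg.lTensor C (Coalgebra.comul (R := K) (c i)) = c i ⊗ₜ[K] 1)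
    (ehP : ∀ p ∈ P, eh.lTensor C (Coalgebra.comul (R := K) p) =
      h ⊗ₜ[K] Coalgebra.counit (R := K) p) :
    KroneckerDatum K C where
  P := RightComodule.ofSubmodule P hP
  finite := hfin
  g := g
  comul_g := hg
  counit_g := hg1
  θ := θ
  cocycle i := RightComodule.lTensor_comul_eq_of_rTensor_eq P hP hg (hθ i)
  counit_θ i := P.lTensor_eq_zero_of_rTensor_eq (hθ i) _ hg1
    (Coalgebra.lTensor_counit_comul _)
  linearIndependent := linearIndependent_of_rTensor_eq P hc hc0 hθ
  eg := eg
  eg_g := egg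
  eg_coact p := P.rTensor_subtype_injective K
    ((RightComodule.lTensor_restrictCoact P hP eg p).trans
      ((egP _ (Subtype.property p)).trans (map_zero _).symm))
  eg_θ i := P.lTensor_eq_zero_of_rTensor_eq (hθ i) _ egg (egc i)
  eh := eh
  h := (⟨h, hhP⟩ : P)
  aug := Coalgebra.counit (R := K) ∘ₗ P.subtype
  aug_h := hh1
  eh_coact p := P.rTensor_subtype_injective K
    ((RightComodule.lTensor_restrictCoact P hP eh p).trans (ehP _ (Subtype.property p)))
  injective_aug := RightComodule.rTensor_counit_restrictCoact_injective P hP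

end

/-! ### Suffixes of the paths in a component -/

namespace PathSpace

section

variable {K : Type*} [Field K] {V : Type*} [Quiver V]

/-- The action of functionals on a subcoalgebra is the restriction of the one on `KQ`. -/
theorem coe_rid_lTensor_comul (C : Subcoalgebra K (PathSpace K V)) (f : PathSpace K V →ₗ[K] K)
    (c : C.toSubmodule) :
    (TensorProduct.rid K C.toSubmodule ((f ∘ₗ C.toSubmodule.subtype).lTensor C.toSubmodule
      (Coalgebra.comul (R := K) c)) : PathSpace K V) = stripRight f c := by
  rw [stripRight, LinearMap.comp_apply, LinearMap.comp_apply, ← C.map_comulLin]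
  change _ = TensorProduct.rid K _ (f.lTensor _ (TensorProduct.map C.toSubmodule.subtype
    C.toSubmodule.subtype (Coalgebra.comul (R := K) c)))
  generalize Coalgebra.comul (R := K) c = z
  induction z with
  | zero => simp
  | add x y hx hy => simp only [map_add, Submodule.coe_add, hx, hy]
  | tmul x y => simp

theorem mem_of_component_eq {x y : V} {c : PathSpace K V} (h : component K x y c = c)
    (W : Submodule K (PathSpace K V))
    (hW : ∀ p : Quiver.Path x y, coeff c ⟨x, y, p⟩ ≠ 0 → ofPath K p ∈ W) : c ∈ W := by
  classical
  have hc : component K x y c ∈ W := by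
    conv => enter [2]; rw [← sum_coeff_smul c]
    rw [map_sum]
    refine Submodule.sum_mem _ ?_
    rintro ⟨a, b, p⟩ hp
    rw [map_smul, component_ofPath]
    refine W.smul_mem _ ?_
    split_ifs with hab
    · obtain ⟨rfl, rfl⟩ := hab
      exact hW p (Finsupp.mem_support_iff.1 hp)
    · exact W.zero_mem
  rwa [h] at hc

/-- The final segments, with starting vertex different from `x`, of the paths from `x` to `y`
occurring in some `c i`. -/
def suffixes {ι : Type*} (x y : V) (c : ι → PathSpace K V) : Set (PathIn V) :=
  {q | q.1 ≠ x ∧ q.2.1 = y ∧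
    ∃ i, ∃ τ : Quiver.Path x q.1, coeff (c i) ⟨x, q.2.1, τ.comp q.2.2⟩ ≠ 0}

theorem finite_suffixes {ι : Type*} [Finite ι] (x y : V) (c : ι → PathSpace K V) :
    (suffixes x y c).Finite := by
  have hfin : (⋃ i, ⋃ p ∈ ((pathBasis K V).repr (c i)).support,
      (fun s : Σ d : V, Quiver.Path p.1 d × Quiver.Path d p.2.1 =>
        (⟨s.1, p.2.1, s.2.2⟩ : PathIn V)) '' {s | s ∈ splits p.2.2}).Finite :=
    Set.finite_iUnion fun i => Set.Finite.biUnion (Finset.finite_toSet _) fun p _ =>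
      (List.finite_toSet _).image _
  refine hfin.subset ?_
  rintro ⟨a, b, η⟩ ⟨-, -, i, τ, hτ⟩
  refine Set.mem_iUnion.2 ⟨i, Set.mem_biUnion (x := ⟨x, b, τ.comp η⟩)
    (Finsupp.mem_support_iff.2 hτ) ⟨⟨a, τ, η⟩, ?_, rfl⟩⟩
  exact (mem_splits _ _ _ _).2 rfl

/-- The span of `suffixes x y c`. -/
noncomputable def suffixSpan {ι : Type*} (x y : V) (c : ι → PathSpace K V) :
    Submodule K (PathSpace K V) :=
  Submodule.span K (pathBasis K V '' suffixes x y c)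

instance {ι : Type*} [Finite ι] (x y : V) (c : ι → PathSpace K V) :
    FiniteDimensional K (suffixSpan x y c) :=
  FiniteDimensional.span_of_finite K ((finite_suffixes x y c).image _)

theorem suffixSpan_le {ι : Type*} {x y : V} {c : ι → PathSpace K V}
    {W : Submodule K (PathSpace K V)}
    (h : ∀ (a : V) (η : Quiver.Path a y), a ≠ x → ⟨a, y, η⟩ ∈ suffixes x y c → ofPath K η ∈ W) :
    suffixSpan x y c ≤ W := by
  refine Submodule.span_le.2 ?_
  rintro _ ⟨⟨a, b, η⟩, hη, rfl⟩
  obtain rfl : b = y := hη.2.1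
  exact h a η hη.1 hη

theorem ofPath_mem_suffixSpan {ι : Type*} {x y : V} {c : ι → PathSpace K V} {a : V}
    {η : Quiver.Path a y} (h : ⟨a, y, η⟩ ∈ suffixes x y c) : ofPath K η ∈ suffixSpan x y c :=
  Submodule.subset_span ⟨_, h, rfl⟩

theorem eq_of_path_of_path (hV : QuiverIsAcyclic V) {a b : V} (p : Quiver.Path a b)
    (q : Quiver.Path b a) : a = b := by
  have h := congrArg Quiver.Path.length (hV a (p.comp q))
  rw [Quiver.Path.length_comp, Quiver.Path.length_nil] at h
  exact Quiver.Path.eq_of_length_zero p (by omega)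

/-- The span of the suffixes is a right coideal: a final segment of a suffix is a suffix, and it
cannot start in `x` as `Q` is acyclic. -/
theorem stripRight_mem_suffixSpan (hV : QuiverIsAcyclic V) {ι : Type*} {x y : V}
    {c : ι → PathSpace K V} (f : PathSpace K V →ₗ[K] K) {w : PathSpace K V}
    (hw : w ∈ suffixSpan x y c) : stripRight f w ∈ suffixSpan x y c := by
  suffices h : suffixSpan x y c ≤ (suffixSpan x y c).comap (stripRight f) from h hw
  refine suffixSpan_le fun a p ha hp => ?_
  rw [Submodule.mem_comap, stripRight_ofPath]
  refine list_sum_mem fun z hz => ?_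
  obtain ⟨⟨d, τ, η⟩, hs, rfl⟩ := List.mem_map.1 hz
  obtain rfl := (mem_splits _ _ _ _).1 hs
  obtain ⟨-, -, i, σ, hσ⟩ := hp
  refine Submodule.smul_mem _ _ (ofPath_mem_suffixSpan ⟨?_, rfl, i, σ.comp τ, ?_⟩)
  · rintro rfl
    exact ha (eq_of_path_of_path hV τ σ)
  · rwa [Quiver.Path.comp_assoc]

theorem stripRight_vertexCoeff_of_component_eq {x y : V} {c : PathSpace K V}
    (h : component K x y c = c) : stripRight (vertexCoeff K x) c = c := by
  refine mem_of_component_eq h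
    (LinearMap.eqLocus (stripRight (vertexCoeff K x)) LinearMap.id) fun p _ => ?_
  classical
  rw [LinearMap.mem_eqLocus, stripRight_vertexCoeff, if_pos rfl, LinearMap.id_apply]

/-- Up to suffixes, a functional acts on `c i` through its value at the trivial path at `x`. -/
theorem stripRight_sub_mem_suffixSpan (hV : QuiverIsAcyclic V) {ι : Type*} {x y : V}
    {c : ι → PathSpace K V} (f : PathSpace K V →ₗ[K] K) (i : ι)
    (h : component K x y (c i) = c i) :
    stripRight f (c i) - f (ofPath K (.nil : Quiver.Path x x)) • c i ∈ suffixSpan x y c := by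
  classical
  -- Subtracting a multiple of the idempotent at `x` reduces to a functional vanishing there.
  let f' := f - f (ofPath K (.nil : Quiver.Path x x)) • vertexCoeff K x
  have hf' : f' (ofPath K (.nil : Quiver.Path x x)) = 0 := by
    simp [f', vertexCoeff_nil]
  have hstrip : stripRight f (c i) - f (ofPath K (.nil : Quiver.Path x x)) • c i =
      stripRight f' (c i) := by
    conv_lhs => enter [2]; rw [← stripRight_vertexCoeff_of_component_eq h]
    simp [stripRight, f', LinearMap.lTensor_sub, LinearMap.lTensor_smul]
  rw [hstrip]
  refine mem_of_component_eq h ((suffixSpan x y c).comap (stripRight f')) fun p hp => ?_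
  rw [Submodule.mem_comap, stripRight_ofPath]
  refine list_sum_mem fun z hz => ?_
  obtain ⟨⟨d, τ, η⟩, hs, rfl⟩ := List.mem_map.1 hz
  obtain rfl := (mem_splits _ _ _ _).1 hs
  by_cases hd : d = x
  · -- By acyclicity the initial segment is trivial, and `f'` kills it.
    subst hd
    obtain rfl := hV _ τ
    simp [hf']
  · exact Submodule.smul_mem _ _ (ofPath_mem_suffixSpan ⟨hd, rfl, i, τ, hp⟩)

theorem nil_mem_suffixSpan {ι : Type*} {x y : V} (hxy : x ≠ y) {c : ι → PathSpace K V} (i : ι)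
    (h : component K x y (c i) = c i) (hc : c i ≠ 0) :
    ofPath K (.nil : Quiver.Path y y) ∈ suffixSpan x y c := by
  obtain ⟨p, hp⟩ : ∃ p : Quiver.Path x y, coeff (c i) ⟨x, y, p⟩ ≠ 0 := by
    by_contra! h0
    exact hc (mem_of_component_eq h ⊥ fun p hp => absurd (h0 p) hp)
  exact ofPath_mem_suffixSpan ⟨hxy.symm, rfl, i, p, hp⟩

theorem stripRight_vertexCoeff_of_mem_suffixSpan {ι : Type*} {x y : V} {c : ι → PathSpace K V}
    {w : PathSpace K V} (hw : w ∈ suffixSpan x y c) : stripRight (vertexCoeff K x) w = 0 := by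
  suffices h : suffixSpan x y c ≤ LinearMap.ker (stripRight (vertexCoeff K x)) from h hw
  classical
  refine suffixSpan_le fun a p ha hp => ?_
  rw [LinearMap.mem_ker, stripRight_vertexCoeff, if_neg ha]

theorem stripRight_vertexCoeff_end_of_mem_suffixSpan (hV : QuiverIsAcyclic V) {ι : Type*} {x y : V}
    {c : ι → PathSpace K V} {w : PathSpace K V} (hw : w ∈ suffixSpan x y c) :
    stripRight (vertexCoeff K y) w =
      Coalgebra.counit (R := K) w • ofPath K (.nil : Quiver.Path y y) := by
  suffices h : suffixSpan x y c ≤ LinearMap.eqLocus (stripRight (vertexCoeff K y))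
      ((Coalgebra.counit (R := K)).smulRight (ofPath K (.nil : Quiver.Path y y))) from h hw
  classical
  refine suffixSpan_le fun a p ha hp => ?_
  rw [LinearMap.mem_eqLocus, stripRight_vertexCoeff, LinearMap.smulRight_apply, counit_ofPath]
  by_cases hay : a = y
  · subst hay
    obtain rfl := hV _ p
    simp
  · rw [if_neg hay, if_neg fun h => hay (Quiver.Path.eq_of_length_zero p h), zero_smul]

theorem counit_eq_zero_of_component_eq {x y : V} (hxy : x ≠ y) {c : PathSpace K V}
    (h : component K x y c = c) : Coalgebra.counit (R := K) c = 0 := by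
  refine mem_of_component_eq h (LinearMap.ker (Coalgebra.counit (R := K))) fun p _ => ?_
  rw [LinearMap.mem_ker, counit_ofPath,
    if_neg fun h => hxy (Quiver.Path.eq_of_length_zero p h)]

theorem finiteDimensional_componentSubmodule_self (hV : QuiverIsAcyclic V)
    (C : Submodule K (PathSpace K V)) (x : V) :
    FiniteDimensional K (componentSubmodule C x x) := by
  refine Submodule.finiteDimensional_of_le
    (S₂ := K ∙ ofPath K (.nil : Quiver.Path x x)) fun c hc => ?_
  refine mem_of_component_eq hc.2 _ fun p _ => ?_
  rw [hV _ p]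
  exact Submodule.mem_span_singleton_self _

/-- For a subcoalgebra, three independent combinations of paths from `x` to `y` give a datum: `g` and
`h` are the trivial paths at `x` and `y`, and `P` consists of the elements of `C` that are
combinations of suffixes. -/
theorem nonempty_kroneckerDatum (hV : QuiverIsAcyclic V)
    {C : Subcoalgebra K (PathSpace K V)} (hC : IsAdmissible C) {x y : V} (hxy : x ≠ y)
    (c : Fin 3 → PathSpace K V) (hc : LinearIndependent K c)
    (hcC : ∀ i, c i ∈ componentSubmodule C.toSubmodule x y) :
    Nonempty (KroneckerDatum K C.toSubmodule) := by
  let P : Submodule K C.toSubmodule := (suffixSpan x y c).comap C.toSubmodule.subtype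
  have hfin : FiniteDimensional K P := Module.Finite.of_injective
    (C.toSubmodule.subtype.restrict (p := P) (q := suffixSpan x y c) fun _ h => h)
    (fun a b hab => Subtype.ext (Subtype.ext
      (congrArg (fun w : suffixSpan x y c => (w : PathSpace K V)) hab)))
  let c' : Fin 3 → C.toSubmodule := fun i => ⟨c i, (hcC i).1⟩
  let g : C.toSubmodule := ⟨_, hC.1 x⟩
  let h : C.toSubmodule := ⟨_, hC.1 y⟩
  have hcomp : ∀ i, component K x y (c i) = c i := fun i => (hcC i).2
  have hP : ∀ p ∈ P, Coalgebra.comul (R := K) p ∈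
      LinearMap.range (P.subtype.rTensor C.toSubmodule) := by
    intro p hp
    refine P.mem_range_rTensor_of_forall _ fun f => ?_
    obtain ⟨f, rfl⟩ := f.exists_extend
    rw [Submodule.mem_comap, Submodule.subtype_apply, coe_rid_lTensor_comul]
    exact stripRight_mem_suffixSpan hV f hp
  have hcP : ∀ i, Coalgebra.comul (R := K) (c' i) - c' i ⊗ₜ[K] g ∈
      LinearMap.range (P.subtype.rTensor C.toSubmodule) := by
    intro i
    refine P.mem_range_rTensor_of_forall _ fun f => ?_
    obtain ⟨f, rfl⟩ := f.exists_extend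
    rw [Submodule.mem_comap, map_sub, map_sub, map_sub, Submodule.subtype_apply,
      coe_rid_lTensor_comul, LinearMap.lTensor_tmul, TensorProduct.rid_tmul]
    exact stripRight_sub_mem_suffixSpan hV f i (hcomp i)
  choose θ hθ using hcP
  have hgrp : ∀ v : V, Coalgebra.comul (R := K) (⟨_, hC.1 v⟩ : C.toSubmodule) =
      (⟨_, hC.1 v⟩ : C.toSubmodule) ⊗ₜ[K] (⟨_, hC.1 v⟩ : C.toSubmodule) := fun v =>
    C.map_subtype_injective ((C.map_comulLin _).trans (comulLin_nil v))
  have hcounit : ∀ v : V, Coalgebra.counit (R := K) (⟨_, hC.1 v⟩ : C.toSubmodule) = 1 := fun v =>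
    (counit_ofPath _).trans (if_pos rfl)
  refine ⟨KroneckerDatum.ofSubmodule P hP g h (hgrp x) (hcounit x)
    (nil_mem_suffixSpan hxy 0 (hcomp 0) (hc.ne_zero 0)) (hcounit y) c'
    (LinearIndependent.of_comp C.toSubmodule.subtype hc)
    (fun i => counit_eq_zero_of_component_eq hxy (hcomp i)) θ hθ
    (vertexCoeff K x ∘ₗ C.toSubmodule.subtype) (vertexCoeff K y ∘ₗ C.toSubmodule.subtype)
    ?_ ?_ ?_ ?_⟩
  · classical
    exact (vertexCoeff_nil x x).trans (if_pos rfl)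
  · intro p hp
    apply (TensorProduct.rid K C.toSubmodule).injective
    apply Subtype.ext
    rw [coe_rid_lTensor_comul, map_zero]
    exact stripRight_vertexCoeff_of_mem_suffixSpan hp
  · intro i
    apply (TensorProduct.rid K C.toSubmodule).injective
    apply Subtype.ext
    rw [coe_rid_lTensor_comul, TensorProduct.rid_tmul, one_smul]
    exact stripRight_vertexCoeff_of_component_eq (hcomp i)
  · intro p hp
    apply (TensorProduct.rid K C.toSubmodule).injective
    apply Subtype.ext
    rw [coe_rid_lTensor_comul, TensorProduct.rid_tmul]
    exact stripRight_vertexCoeff_end_of_mem_suffixSpan hV hp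

end

end PathSpace

/-! ### Wildness -/

theorem mainTheorem2 {K : Type*} [Field K] [IsAlgClosed K]
    {V : Type*} [Quiver V] (hV : QuiverIsAcyclic V)
    (C : Subcoalgebra K (PathSpace K V)) (hC : PathSpace.IsAdmissible C)
    (hrel : ¬ PathSpace.IsPathCoalgebraOfRelations C) :
    IsWildComoduleType K C.toSubmodule := by
  obtain ⟨x, y, hinf⟩ := PathSpace.exists_infinite_componentSubmodule hC hrel
  have hxy : x ≠ y := by
    rintro rfl
    exact hinf (PathSpace.finiteDimensional_componentSubmodule_self hV C.toSubmodule x)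
  have hrank : ((3 : ℕ) : Cardinal) ≤
      Module.rank K (PathSpace.componentSubmodule C.toSubmodule x y) := by
    by_contra hlt
    exact hinf (Module.rank_lt_aleph0_iff.1
      ((lt_of_not_ge hlt).trans (Cardinal.natCast_lt_aleph0)))
  obtain ⟨c, hc⟩ := exists_linearIndependent_of_le_rank hrank
  obtain ⟨D⟩ := PathSpace.nonempty_kroneckerDatum hV hC hxy (fun i => (c i : PathSpace K V))
    (hc.map' (Submodule.subtype _) (Submodule.ker_subtype _)) fun i => (c i).2
  exact D.isWildComoduleType
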